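/- Let $\Gamma$ be a discrete group of type $FP_\infty(\mathbb{Q})$, i.e. for every $m$ the trivial $\mathbb{Q}\Gamma$-module $\mathbb{Q}$ has a projective $\mathbb{Q}\Gamma$-resolution that is finitely generated in degrees up to $m$, and let $n\ge 1$. A unitary $\Gamma$-module is a complex Hilbert space with a homomorphism from $\Gamma$ to its unitary operators. $\Gamma$ has property $[T_n]$ if $H^j(\Gamma,V)=0$ for every unitary $\Gamma$-module $V$ and every $1\le j\le n$; it has property $(T_n)$ if this holds for every unitary $\Gamma$-module $V$ without non-zero $\Gamma$-invariant vectors. Let $C^*\Gamma$ be the maximal $C^*$-algebra of $\Gamma$, the completion of $\mathbb{C}\Gamma$ in the norm $\|x\|=\sup_\sigma\|\sigma(x)\|$ over all unitary representations $\sigma$ of $\Gamma$, and let $C^*_0\Gamma$ be the kernel of the augmentation homomorphism $\varepsilon\colon C^*\Gamma\to\mathbb{C}$, $\varepsilon(\gamma)=1$ for $\gamma\in\Gamma$. Modules are complex vector spaces and unital; a Banach module over an algebra is a Banach space with a module structure by bounded operators. For a Banach $\Gamma$-module $V$, the space $H^m(\Gamma,V)$ carries its canonical topology (the quotient topology on cocycles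 modulo coboundaries, where the cochains $\Gamma^m\to V$ have the topology of pointwise convergence). (1) If $\Gamma$ has property $[T_n]$, then $H^k(\Gamma,V)=H_k(\Gamma,V)=0$ for every $C^*\Gamma$-module $V$ and every $1\le k\le n$, and $H^{n+1}(\Gamma,V)$ is Hausdorff for every Banach $C^*\Gamma$-module $V$. (2) If $\Gamma$ has property $(T_n)$, then the algebra $C^*_0\Gamma$ has an identity element $e$, and, with $\gamma\in\Gamma$ acting on $C^*_0\Gamma$-modules through $\gamma e\in C^*_0\Gamma$, one has $H^k(\Gamma,V)=H_k(\Gamma,V)=0$ for every $C^*_0\Gamma$-module $V$ and every $0\le k\le n$, and $H^{n+1}(\Gamma,V)$ is Hausdorff for every Banach $C^*_0\Gamma$-module $V$. (3) If $\Gamma$ has property $(T_n)$, then $H^{n+1}(\Gamma,V)$ is Hausdorff for every unitary $\Gamma$-module $V$. -/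

import Mathlib

open CategoryTheory

noncomputable section

/-! ### Unitary representations -/

/-- A unitary representation (synonymously, a unitary `Γ`-module) of a discrete group `Γ`: a complex
Hilbert space with a group homomorphism from `Γ` to its unitary operators. -/
structure UnitaryRep (Γ : Type) [Group Γ] : Type 1 where
  /-- the Hilbert space -/
  H : Type
  [normed : NormedAddCommGroup H]
  [inner : InnerProductSpace ℂ H]
  [complete : CompleteSpace H]
  /-- the action -/
  π : Γ →* unitary (H →L[ℂ] H)

attribute [instance] UnitaryRep.normed UnitaryRep.inner UnitaryRep.complete

namespace UnitaryRep

variable {Γ : Type} [Group Γ]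

/-- The underlying linear representation on the vector space `H`. -/
def rep (σ : UnitaryRep Γ) : Representation ℂ Γ σ.H where
  toFun g := ((σ.π g : σ.H →L[ℂ] σ.H) : σ.H →ₗ[ℂ] σ.H)
  map_one' := by ext; simp
  map_mul' g h := by ext; simp

/-- The extension of a unitary representation to the group algebra `ℂΓ`. -/
def ext (σ : UnitaryRep Γ) : MonoidAlgebra ℂ Γ →ₐ[ℂ] (σ.H →L[ℂ] σ.H) :=
  MonoidAlgebra.lift ℂ (σ.H →L[ℂ] σ.H) Γ ((unitary (σ.H →L[ℂ] σ.H)).subtype.comp σ.π)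

/-- There are no non-zero invariant vectors. -/
def NoInvariants (σ : UnitaryRep Γ) : Prop :=
  ∀ v : σ.H, (∀ g : Γ, (σ.π g : σ.H →L[ℂ] σ.H) v = v) → v = 0

/-- The trivial one-dimensional representation. -/
def triv (Γ : Type) [Group Γ] : UnitaryRep Γ where
  H := ℂ
  π := 1

end UnitaryRep

/-! ### The maximal group C⋆-algebra -/

/-- The group algebra `ℂΓ`, to be equipped with the maximal C⋆-seminorm. -/
def GroupAlg (Γ : Type) [Group Γ] : Type := MonoidAlgebra ℂ Γ

namespace GroupAlg

variable {Γ : Type} [Group Γ]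

instance : Ring (GroupAlg Γ) := inferInstanceAs (Ring (MonoidAlgebra ℂ Γ))
instance : Algebra ℂ (GroupAlg Γ) := inferInstanceAs (Algebra ℂ (MonoidAlgebra ℂ Γ))

/-- A unitary representation as an algebra homomorphism out of `ℂΓ`. -/
def act (σ : UnitaryRep Γ) : GroupAlg Γ →ₐ[ℂ] (σ.H →L[ℂ] σ.H) := σ.ext

/-- The group element `g` in `ℂΓ`. -/
def of : Γ →* GroupAlg Γ := MonoidAlgebra.of ℂ Γ

lemma act_of (σ : UnitaryRep Γ) (g : Γ) : act σ (of g) = (σ.π g : σ.H →L[ℂ] σ.H) := by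
  change MonoidAlgebra.lift ℂ _ Γ _ (MonoidAlgebra.of ℂ Γ g) = _
  simp

lemma induction {P : GroupAlg Γ → Prop} (h1 : ∀ g, P (of g)) (h2 : ∀ x y, P x → P y → P (x + y))
    (h3 : ∀ (c : ℂ) x, P x → P (c • x)) (x : GroupAlg Γ) : P x :=
  MonoidAlgebra.induction_on (motive := P) x h1 h2 h3

/-- The maximal C⋆-seminorm `‖x‖ = sup_σ ‖σ(x)‖`, over all unitary representations `σ`. -/
instance : Norm (GroupAlg Γ) := ⟨fun x => ⨆ σ : UnitaryRep Γ, ‖act σ x‖⟩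

lemma norm_def (x : GroupAlg Γ) : ‖x‖ = ⨆ σ : UnitaryRep Γ, ‖act σ x‖ := rfl

lemma bddAbove (x : GroupAlg Γ) : BddAbove (Set.range fun σ : UnitaryRep Γ => ‖act σ x‖) := by
  induction x using induction with
  | h1 g =>
    refine ⟨1, ?_⟩
    rintro _ ⟨σ, rfl⟩
    simp only [act_of]
    refine ContinuousLinearMap.opNorm_le_bound _ zero_le_one fun v => ?_
    rw [Unitary.norm_map, one_mul]
  | h2 x y hx hy =>
    obtain ⟨a, ha⟩ := hx
    obtain ⟨b, hb⟩ := hy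
    refine ⟨a + b, ?_⟩
    rintro _ ⟨σ, rfl⟩
    simp only [map_add]
    exact (norm_add_le _ _).trans (add_le_add (ha ⟨σ, rfl⟩) (hb ⟨σ, rfl⟩))
  | h3 c x hx =>
    obtain ⟨a, ha⟩ := hx
    refine ⟨‖c‖ * a, ?_⟩
    rintro _ ⟨σ, rfl⟩
    simp only [map_smul, norm_smul]
    exact mul_le_mul_of_nonneg_left (ha ⟨σ, rfl⟩) (norm_nonneg _)

instance : Nonempty (UnitaryRep Γ) := ⟨UnitaryRep.triv Γ⟩

lemma norm_act_le (σ : UnitaryRep Γ) (x : GroupAlg Γ) : ‖act σ x‖ ≤ ‖x‖ :=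
  le_ciSup (bddAbove x) σ

lemma norm_nonneg' (x : GroupAlg Γ) : 0 ≤ ‖x‖ :=
  (norm_nonneg _).trans (norm_act_le (UnitaryRep.triv Γ) x)

instance : SeminormedAddCommGroup (GroupAlg Γ) :=
  AddGroupSeminorm.toSeminormedAddCommGroup
    { toFun := fun x => ‖x‖
      map_zero' := by simp [norm_def]
      add_le' := fun x y => ciSup_le fun σ => by
        rw [map_add]
        exact (norm_add_le _ _).trans (add_le_add (norm_act_le σ x) (norm_act_le σ y))
      neg' := fun x => by simp [norm_def] }

instance : SeminormedRing (GroupAlg Γ) where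
  __ := (inferInstance : SeminormedAddCommGroup (GroupAlg Γ))
  __ := (inferInstance : Ring (GroupAlg Γ))
  norm_mul_le x y := ciSup_le fun σ => by
    rw [map_mul]
    exact (norm_mul_le _ _).trans
      (mul_le_mul (norm_act_le σ x) (norm_act_le σ y) (norm_nonneg _) (norm_nonneg' x))

instance : NormedAlgebra ℂ (GroupAlg Γ) where
  norm_smul_le c x := ciSup_le fun σ => by
    rw [map_smul, norm_smul]
    exact mul_le_mul_of_nonneg_left (norm_act_le σ x) (norm_nonneg _)

/-- The involution of `ℂΓ`: `(∑ a_g g)⋆ = ∑ conj(a_g) g⁻¹`. -/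
instance : Star (GroupAlg Γ) :=
  ⟨fun x => (MonoidAlgebra.coeff (R := ℂ) (M := Γ) x).sum
    fun g a => (starRingEnd ℂ a) • (of g⁻¹ : GroupAlg Γ)⟩

lemma star_add' (x y : GroupAlg Γ) : star (x + y) = star x + star y := by
  change Finsupp.sum _ _ = Finsupp.sum _ _ + Finsupp.sum _ _
  rw [← Finsupp.sum_add_index']
  · rfl
  · intro g; simp
  · intro g a b; rw [map_add, add_smul]

lemma star_smul' (c : ℂ) (x : GroupAlg Γ) : star (c • x) = star c • star x := by
  change Finsupp.sum (c • _) _ = star c • Finsupp.sum _ _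
  rw [Finsupp.sum_smul_index' (fun g => by simp), Finsupp.smul_sum]
  refine Finset.sum_congr rfl fun g _ => ?_
  change starRingEnd ℂ (c * MonoidAlgebra.coeff (R := ℂ) (M := Γ) x g) • (of g⁻¹ : GroupAlg Γ) =
    starRingEnd ℂ c • starRingEnd ℂ (MonoidAlgebra.coeff (R := ℂ) (M := Γ) x g) • of g⁻¹
  rw [map_mul, mul_smul]

lemma star_of (g : Γ) : star (of g : GroupAlg Γ) = of g⁻¹ := by
  change Finsupp.sum (Finsupp.single g (1 : ℂ)) _ = _
  rw [Finsupp.sum_single_index (by simp), map_one, one_smul]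

lemma star_mul_of (x : GroupAlg Γ) (h : Γ) : star (x * of h) = star (of h) * star x := by
  induction x using induction with
  | h1 g => rw [← map_mul, star_of, star_of, star_of, ← map_mul, mul_inv_rev]
  | h2 x y hx hy => rw [add_mul, star_add', star_add', mul_add, hx, hy]
  | h3 c x hx => rw [smul_mul_assoc, star_smul', star_smul', mul_smul_comm, hx]

instance : StarRing (GroupAlg Γ) where
  star_involutive x := by
    induction x using induction with
    | h1 g => rw [star_of, star_of, inv_inv]
    | h2 x y hx hy => rw [star_add', star_add', hx, hy]
    | h3 c x hx => rw [star_smul', star_smul', hx, star_star]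
  star_mul x y := by
    induction y using induction with
    | h1 g => exact star_mul_of x g
    | h2 y z hy hz => rw [mul_add, star_add', star_add', add_mul, hy, hz]
    | h3 c y hy => rw [mul_smul_comm, star_smul', star_smul', smul_mul_assoc, hy]
  star_add := star_add'

instance : StarModule ℂ (GroupAlg Γ) := ⟨star_smul'⟩

lemma act_star (σ : UnitaryRep Γ) (x : GroupAlg Γ) : act σ (star x) = star (act σ x) := by
  induction x using induction with
  | h1 g => rw [star_of, act_of, act_of, map_inv]; rfl
  | h2 x y hx hy => rw [star_add, map_add, map_add, star_add, hx, hy]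
  | h3 c x hx => rw [star_smul, map_smul, map_smul, star_smul, hx]

lemma norm_star' (x : GroupAlg Γ) : ‖star x‖ = ‖x‖ := by
  change (⨆ σ : UnitaryRep Γ, ‖act σ (star x)‖) = ⨆ σ : UnitaryRep Γ, ‖act σ x‖
  simp only [act_star, norm_star]

/-- The C⋆-identity for the maximal seminorm. -/
lemma norm_mul_self_le_norm_star_mul (x : GroupAlg Γ) : ‖x‖ * ‖x‖ ≤ ‖star x * x‖ := by
  rw [← sq]
  refine (Real.le_sqrt (norm_nonneg _) (norm_nonneg _)).1 ?_
  refine ciSup_le fun σ => Real.le_sqrt_of_sq_le ?_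
  rw [sq, ← CStarRing.norm_star_mul_self, ← act_star, ← map_mul]
  exact norm_act_le σ _

/-- The augmentation `ε : ℂΓ → ℂ`, `ε(g) = 1` for `g ∈ Γ`. -/
def augmentation : GroupAlg Γ →ₐ[ℂ] ℂ := MonoidAlgebra.lift ℂ ℂ Γ 1

lemma augmentation_of (g : Γ) : augmentation (of g) = 1 := by
  change MonoidAlgebra.lift ℂ _ Γ _ (MonoidAlgebra.of ℂ Γ g) = _
  simp

lemma act_triv (x : GroupAlg Γ) (w : ℂ) : act (UnitaryRep.triv Γ) x w = augmentation x * w := by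
  induction x using induction with
  | h1 g => rw [act_of, augmentation_of, one_mul]; rfl
  | h2 x y hx hy => rw [map_add, map_add, add_mul, ← hx, ← hy]; rfl
  | h3 c x hx => rw [map_smul, map_smul, smul_eq_mul, mul_assoc, ← hx]; rfl

lemma norm_augmentation_le (x : GroupAlg Γ) : ‖augmentation x‖ ≤ 1 * ‖x‖ := by
  have h1 : ‖act (UnitaryRep.triv Γ) x (1 : ℂ)‖ ≤ ‖act (UnitaryRep.triv Γ) x‖ * ‖(1 : ℂ)‖ :=
    ContinuousLinearMap.le_opNorm _ _
  rw [act_triv, mul_one, norm_one, mul_one] at h1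
  rw [one_mul]
  exact h1.trans (norm_act_le (UnitaryRep.triv Γ) x)

lemma continuous_augmentation : Continuous (augmentation : GroupAlg Γ →ₐ[ℂ] ℂ) :=
  AddMonoidHomClass.continuous_of_bound augmentation 1 norm_augmentation_le

end GroupAlg

/-- The maximal C⋆-algebra `C⋆Γ` of the group `Γ`: the completion of `ℂΓ` in the maximal
C⋆-seminorm. -/
abbrev MaxCStar (Γ : Type) [Group Γ] : Type := UniformSpace.Completion (GroupAlg Γ)

namespace MaxCStar

open UniformSpace

variable {Γ : Type} [Group Γ]

instance : NormedAlgebra ℂ (MaxCStar Γ) where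
  norm_smul_le := norm_smul_le

lemma uniformContinuous_star : UniformContinuous (star : GroupAlg Γ → GroupAlg Γ) :=
  uniformContinuous_of_continuousAt_zero (starAddEquiv : GroupAlg Γ ≃+ GroupAlg Γ) <| by
    refine (AddMonoidHomClass.continuous_of_bound (starAddEquiv : GroupAlg Γ ≃+ GroupAlg Γ) 1
      fun x => ?_).continuousAt
    rw [one_mul]
    exact (GroupAlg.norm_star' x).le

/-- The involution of `C⋆Γ`, extending that of `ℂΓ` by continuity. -/
instance : Star (MaxCStar Γ) := ⟨Completion.map star⟩

lemma star_coe (x : GroupAlg Γ) : star (x : MaxCStar Γ) = ((star x : GroupAlg Γ) : MaxCStar Γ) :=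
  Completion.map_coe uniformContinuous_star x

lemma continuous_star' : Continuous (star : MaxCStar Γ → MaxCStar Γ) := Completion.continuous_map

instance : StarRing (MaxCStar Γ) where
  star_involutive x := by
    induction x using Completion.induction_on with
    | hp => exact isClosed_eq (continuous_star'.comp continuous_star') continuous_id
    | ih x => rw [star_coe, star_coe, star_star]
  star_mul x y := by
    induction x, y using Completion.induction_on₂ with
    | hp =>
      exact isClosed_eq (continuous_star'.comp (continuous_fst.mul continuous_snd))
        ((continuous_star'.comp continuous_snd).mul (continuous_star'.comp continuous_fst))
    | ih x y =>
      rw [← Completion.coe_mul, star_coe, star_coe, star_coe, star_mul, Completion.coe_mul]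
  star_add x y := by
    induction x, y using Completion.induction_on₂ with
    | hp =>
      exact isClosed_eq (continuous_star'.comp (continuous_fst.add continuous_snd))
        ((continuous_star'.comp continuous_fst).add (continuous_star'.comp continuous_snd))
    | ih x y =>
      rw [← Completion.coe_add, star_coe, star_coe, star_coe, star_add, Completion.coe_add]

/-- `C⋆Γ` is a unital C⋆-algebra. -/
instance : CStarAlgebra (MaxCStar Γ) where
  star_smul c x := by
    induction x using Completion.induction_on with
    | hp =>
      exact isClosed_eq (continuous_star'.comp (continuous_const_smul c))
        ((continuous_const_smul (star c)).comp continuous_star')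
    | ih x => rw [← Completion.coe_smul, star_coe, star_coe, star_smul, Completion.coe_smul]
  norm_mul_self_le x := by
    induction x using Completion.induction_on with
    | hp =>
      exact isClosed_le (continuous_norm.mul continuous_norm)
        (continuous_norm.comp (continuous_star'.mul continuous_id))
    | ih x =>
      rw [star_coe, ← Completion.coe_mul, Completion.norm_coe, Completion.norm_coe]
      exact GroupAlg.norm_mul_self_le_norm_star_mul x

/-- The group element `g` in `C⋆Γ`. -/
def of : Γ →* MaxCStar Γ :=
  (Completion.coeRingHom : GroupAlg Γ →+* MaxCStar Γ).toMonoidHom.comp GroupAlg.of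

/-- The augmentation homomorphism `ε : C⋆Γ → ℂ`, extending `ε : ℂΓ → ℂ` by continuity. -/
def augmentation : MaxCStar Γ →ₐ[ℂ] ℂ where
  __ := Completion.extensionHom (GroupAlg.augmentation : GroupAlg Γ →ₐ[ℂ] ℂ).toRingHom
    GroupAlg.continuous_augmentation
  commutes' c := by
    refine (Completion.extensionHom_coe (GroupAlg.augmentation : GroupAlg Γ →ₐ[ℂ] ℂ).toRingHom
      GroupAlg.continuous_augmentation (algebraMap ℂ (GroupAlg Γ) c)).trans ?_
    exact AlgHom.commutes GroupAlg.augmentation c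

lemma augmentation_of (g : Γ) : augmentation (of g : MaxCStar Γ) = 1 :=
  (Completion.extensionHom_coe (GroupAlg.augmentation : GroupAlg Γ →ₐ[ℂ] ℂ).toRingHom
    GroupAlg.continuous_augmentation (GroupAlg.of g)).trans (GroupAlg.augmentation_of g)

variable (Γ) in
/-- `C⋆₀Γ`, the kernel of the augmentation `C⋆Γ → ℂ`. It is a two-sided ideal, considered here
as an algebra in its own right, which a priori need not have an identity element. -/
def C0 : NonUnitalSubalgebra ℂ (MaxCStar Γ) where
  carrier := {a | augmentation a = 0}
  zero_mem' := map_zero _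
  add_mem' {a b} ha hb := by
    rw [Set.mem_ofPred_eq] at *
    rw [map_add, ha, hb, add_zero]
  mul_mem' {a b} ha hb := by
    rw [Set.mem_ofPred_eq] at *
    rw [map_mul, ha, zero_mul]
  smul_mem' c a ha := by
    rw [Set.mem_ofPred_eq] at *
    rw [map_smul, ha, smul_zero]

/-- Left multiplication of `C⋆₀Γ` by a group element. -/
def C0.lmul (g : Γ) (a : C0 Γ) : C0 Γ :=
  ⟨of g * a, by
    have ha : augmentation (a : MaxCStar Γ) = 0 := a.2
    change augmentation (of g * (a : MaxCStar Γ)) = 0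
    rw [map_mul, ha, mul_zero]⟩

/-- `e` is an identity element of `C⋆₀Γ`. -/
def C0.IsIdentity (e : C0 Γ) : Prop := ∀ a : C0 Γ, e * a = a ∧ a * e = a

end MaxCStar

/-! ### Modules and the induced actions of the group -/

section Modules

open MaxCStar

variable {Γ : Type} [Group Γ]

/-- The linear `Γ`-representation underlying a `C⋆Γ`-module. A module over the unital `ℂ`-algebra
`C⋆Γ` is given by a complex vector space `V` and a unital algebra homomorphism
`m : C⋆Γ → End(V)`. -/
def cstarRep {V : Type} [AddCommGroup V] [Module ℂ V] (m : MaxCStar Γ →ₐ[ℂ] Module.End ℂ V) :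
    Representation ℂ Γ V :=
  (m : MaxCStar Γ →* Module.End ℂ V).comp MaxCStar.of

/-- The linear `Γ`-representation underlying a unital `C⋆₀Γ`-module, when `C⋆₀Γ` has the identity
element `e`: the group element `g` acts as `g e ∈ C⋆₀Γ`. A unital module over `C⋆₀Γ` is given by a
complex vector space `V` and an algebra homomorphism `m : C⋆₀Γ → End(V)` with `m(e) = 1`. -/
def cstarZeroRep {e : C0 Γ} (he : C0.IsIdentity e) {V : Type} [AddCommGroup V] [Module ℂ V]
    (m : C0 Γ →ₙₐ[ℂ] Module.End ℂ V) (hm : m e = 1) : Representation ℂ Γ V where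
  toFun g := m (C0.lmul g e)
  map_one' := by
    rw [← hm]
    congr 1
    ext
    simp [C0.lmul]
  map_mul' g h := by
    rw [← map_mul]
    congr 1
    have h1 := congrArg Subtype.val (he (C0.lmul h e)).1
    ext
    change of (g * h) * (e : MaxCStar Γ) = of g * e * (of h * e)
    change (e : MaxCStar Γ) * (of h * e) = of h * e at h1
    rw [mul_assoc (of g), h1, map_mul, mul_assoc]

/-- The bounded operators on `V`, as a subalgebra of all linear operators. -/
abbrev opIncl (V : Type) [NormedAddCommGroup V] [NormedSpace ℂ V] :
    (V →L[ℂ] V) →ₐ[ℂ] Module.End ℂ V where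
  toFun f := (f : V →ₗ[ℂ] V)
  map_one' := rfl
  map_mul' _ _ := rfl
  map_zero' := rfl
  map_add' _ _ := rfl
  commutes' _ := rfl

/-- The linear `Γ`-representation underlying a Banach `C⋆Γ`-module, i.e. a Banach space `V` with a
`C⋆Γ`-module structure by bounded operators. (An inequality `‖a v‖ ≤ C ‖a‖ ‖v‖` is not required;
modules that satisfy one are included.) -/
def banachRep {V : Type} [NormedAddCommGroup V] [NormedSpace ℂ V]
    (m : MaxCStar Γ →ₐ[ℂ] (V →L[ℂ] V)) : Representation ℂ Γ V :=
  cstarRep ((opIncl V).comp m)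

/-- The linear `Γ`-representation underlying a unital Banach `C⋆₀Γ`-module. -/
def banachZeroRep {e : C0 Γ} (he : C0.IsIdentity e) {V : Type} [NormedAddCommGroup V]
    [NormedSpace ℂ V] (m : C0 Γ →ₙₐ[ℂ] (V →L[ℂ] V)) (hm : m e = 1) : Representation ℂ Γ V :=
  cstarZeroRep he ((opIncl V : (V →L[ℂ] V) →ₙₐ[ℂ] Module.End ℂ V).comp m)
    (congrArg (opIncl V) hm)

end Modules

/-! ### Group (co)homology -/

section Cohomology

variable {Γ : Type} [Group Γ]

/-- The canonical topology on `Hⁿ(Γ, V)` for a discrete group `Γ` and a topological vector space `V`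
with a linear `Γ`-action: cochains are functions `Γⁿ → V` with the topology of pointwise
convergence, cocycles have the subspace topology, and cohomology has the quotient topology. -/
@[reducible] def cohomologyTopology {V : Type} [AddCommGroup V] [Module ℂ V] [TopologicalSpace V]
    (ρ : Representation ℂ Γ V) (n : ℕ) : TopologicalSpace (groupCohomology (Rep.of ρ) n) :=
  TopologicalSpace.coinduced (groupCohomology.π (Rep.of ρ) n)
    (TopologicalSpace.induced
      (fun z => (groupCohomology.iCocycles (Rep.of ρ) n z : (Fin n → Γ) → V)) inferInstance)

/-- `Hⁿ(Γ, V)` is Hausdorff in its canonical topology. -/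
def HausdorffCohomology {V : Type} [AddCommGroup V] [Module ℂ V] [TopologicalSpace V]
    (ρ : Representation ℂ Γ V) (n : ℕ) : Prop :=
  @T2Space (groupCohomology (Rep.of ρ) n) (cohomologyTopology ρ n)

/-- `Hⁿ(Γ, V) = 0`. -/
def CohomologyVanishes {V : Type} [AddCommGroup V] [Module ℂ V]
    (ρ : Representation ℂ Γ V) (n : ℕ) : Prop :=
  Subsingleton (groupCohomology (Rep.of ρ) n)

/-- `Hₙ(Γ, V) = 0`. -/
def HomologyVanishes {V : Type} [AddCommGroup V] [Module ℂ V]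
    (ρ : Representation ℂ Γ V) (n : ℕ) : Prop :=
  Subsingleton (groupHomology (Rep.of ρ) n)

variable (Γ) in
/-- Property `[Tₙ]`: `Hʲ(Γ, V) = 0` for all unitary `V` and all `1 ≤ j ≤ n`. -/
def HasBracketT (n : ℕ) : Prop :=
  ∀ σ : UnitaryRep Γ, ∀ j : ℕ, 1 ≤ j → j ≤ n → CohomologyVanishes σ.rep j

variable (Γ) in
/-- Property `(Tₙ)`: `Hʲ(Γ, V) = 0` for all unitary `V` without non-zero invariant vectors and all
`1 ≤ j ≤ n`. -/
def HasParenT (n : ℕ) : Prop :=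
  ∀ σ : UnitaryRep Γ, σ.NoInvariants → ∀ j : ℕ, 1 ≤ j → j ≤ n → CohomologyVanishes σ.rep j

variable (Γ) in
/-- The finiteness property `FPₙ(ℚ)`: the trivial `ℚΓ`-module `ℚ` has a projective resolution that
is finitely generated over `ℚΓ` in degrees up to `n`. -/
def IsFPRat (n : ℕ) : Prop :=
  ∃ P : ProjectiveResolution (Rep.trivial ℚ Γ ℚ),
    ∀ i ≤ n, Module.Finite (MonoidAlgebra ℚ Γ) (P.complex.X i).ρ.asModule

variable (Γ) in
/-- The finiteness property `FP_∞(ℚ)`: `FPₙ(ℚ)` for all `n`. -/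
def IsFPInftyRat : Prop := ∀ n : ℕ, IsFPRat Γ n

end Cohomology

end

/-! Finiteness lets a single pair of matrices over `ℂΓ` compute cohomology for all coefficients. In
each degree `k` there are finite matrices `D` and `D'` with `D' * D = 0`. For every `Γ`-module `V`,
`Hᵏ(Γ, V)` is zero exactly when `ker D' = im D` on tuples from `V`, and closed range of `D'` makes
`Hᵏ⁺¹(Γ, V)` Hausdorff (`IsFPRat.exists_isCohomologyPresentation`). The theorem thus reduces to
matrix identities over `C⋆Γ`. An identity `D X + Y D' = 1` kills the cohomology of every
`C⋆Γ`-module. A quasi-inverse, `D' G D' = D'`, exhibits the range of `D'` as the fixed set of the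
continuous operator `D' G`.

The identities come from inverting the Laplacian `D'ᴴ D' + D Dᴴ`. Under `(Tₙ)` the complex is exact
in degrees up to `n` on each unitary representation without invariant vectors. If the Laplacian had
no uniform lower bound there, an ultraproduct of almost harmonic unit vectors would yield a harmonic
unit vector, contradicting exactness (`boundedBelow_of_exact`). Exactness applies to the
ultraproduct only if it has no invariant vectors. This is Kazhdan's spectral gap, obtained from
vanishing in degrees 0 and 1 (`HasParenT.exists_column`).

The same gap produces a central projection `p` in `C⋆Γ` onto the invariant vectors, as a limit of
powers of an element of `ℂΓ` (`exists_isKazhdanProjection`). On the complement of `p` a Neumann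
series inverts the Laplacian, so `D X + Y D' = 1 - p` (`exists_homotopy`). On the range of `p` every
matrix becomes a complex matrix through the augmentation, and finite-dimensional linear algebra
applies. It always supplies a quasi-inverse, hence the Hausdorff statements. Under `[Tₙ]`, in
degrees `1 ≤ k ≤ n`, it also supplies a homotopy, hence vanishing for all modules.

The identity of `C⋆₀Γ` is `1 - p`, and its unital modules are the `C⋆Γ`-modules on which `1 - p`
acts as the identity. Homology follows from cohomology of the conjugate dual module. -/

noncomputable section

/-! ### Constructions with unitary representations: completion, Hilbert sum, invariant vectors. -/

namespace UnitaryRep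

variable {Γ : Type} [Group Γ]

lemma rep_apply (σ : UnitaryRep Γ) (g : Γ) (v : σ.H) :
    σ.rep g v = (σ.π g : σ.H →L[ℂ] σ.H) v := rfl

lemma norm_rep (σ : UnitaryRep Γ) (g : Γ) (v : σ.H) : ‖σ.rep g v‖ = ‖v‖ := by
  rw [rep_apply, Unitary.norm_map]

/-- A representation by isometries on a Hilbert space is unitary. -/
def ofIsometric {H : Type} [NormedAddCommGroup H] [InnerProductSpace ℂ H] [CompleteSpace H]
    (ρ : Representation ℂ Γ H) (h : ∀ g v, ‖ρ g v‖ = ‖v‖) : UnitaryRep Γ where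
  H := H
  π := (Unitary.linearIsometryEquiv (𝕜 := ℂ) (H := H)).symm.toMonoidHom.comp
    { toFun := fun g =>
        { toLinearEquiv := LinearEquiv.ofLinearMap (ρ g) (ρ g⁻¹)
            (by ext v; simp [← Module.End.mul_apply, ← map_mul])
            (by ext v; simp [← Module.End.mul_apply, ← map_mul])
          norm_map' := h g }
      map_one' := by ext v; simp
      map_mul' := fun g k => by
        ext v
        change ρ (g * k) v = ρ g (ρ k v)
        simp }

/-- The Hilbert space completion of a representation with an invariant positive semidefinite
form. -/
theorem exists_completion {E : Type} [AddCommGroup E] [Module ℂ E] (ρ : Representation ℂ Γ E)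
    (c : PreInnerProductSpace.Core ℂ E)
    (hc : ∀ g x y, c.inner (ρ g x) (ρ g y) = c.inner x y) :
    ∃ (τ : UnitaryRep Γ) (Q : E →ₗ[ℂ] τ.H), DenseRange Q ∧
      (∀ g x, τ.rep g (Q x) = Q (ρ g x)) ∧
      ∀ x y, Inner.inner ℂ (Q x) (Q y) = c.inner x y := by
  let : SeminormedAddCommGroup E := InnerProductSpace.Core.toSeminormedAddCommGroup (c := c)
  let : InnerProductSpace ℂ E := InnerProductSpace.ofCore c
  have hin : ∀ x y : E, Inner.inner ℂ x y = c.inner x y := fun _ _ => rfl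
  have hn : ∀ g x, ‖ρ g x‖ = ‖x‖ := fun g x => by
    rw [@norm_eq_sqrt_re_inner ℂ, @norm_eq_sqrt_re_inner ℂ, hin, hin, hc]
  let T : Γ → (E →L[ℂ] E) := fun g => (ρ g).mkContinuous 1 fun x => by rw [hn, one_mul]
  have hT : ∀ g x, T g x = ρ g x := fun _ _ => rfl
  have h1 : ∀ x, (T 1).completion x = x := fun x => by
    induction x using UniformSpace.Completion.induction_on with
    | hp => exact isClosed_eq (T 1).completion.continuous continuous_id
    | ih x => simp [hT]
  have h2 : ∀ g k x, (T (g * k)).completion x = (T g).completion ((T k).completion x) := by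
    intro g k x
    induction x using UniformSpace.Completion.induction_on with
    | hp =>
      exact isClosed_eq (T (g * k)).completion.continuous
        ((T g).completion.continuous.comp (T k).completion.continuous)
    | ih x => simp [hT]
  let ρ' : Representation ℂ Γ (UniformSpace.Completion E) :=
    { toFun := fun g => ((T g).completion : _ →ₗ[ℂ] _)
      map_one' := LinearMap.ext h1
      map_mul' := fun g k => LinearMap.ext (h2 g k) }
  have hρ' : ∀ g (x : E), ρ' g (x : UniformSpace.Completion E) = (ρ g x : E) := fun g x => by
    change (T g).completion x = _
    rw [ContinuousLinearMap.completion_apply_coe, hT]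
  have hiso : ∀ g x, ‖ρ' g x‖ = ‖x‖ := fun g x => by
    induction x using UniformSpace.Completion.induction_on with
    | hp => exact isClosed_eq (continuous_norm.comp (T g).completion.continuous) continuous_norm
    | ih x => rw [hρ', UniformSpace.Completion.norm_coe, UniformSpace.Completion.norm_coe, hn]
  let Q : E →ₗ[ℂ] UniformSpace.Completion E :=
    (UniformSpace.Completion.toComplL (𝕜 := ℂ) (E := E) : E →ₗ[ℂ] UniformSpace.Completion E)
  have hQd : DenseRange Q := UniformSpace.Completion.denseRange_coe
  have hQi : ∀ x y, Inner.inner ℂ (Q x) (Q y) = c.inner x y :=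
    fun x y => UniformSpace.Completion.inner_coe x y
  exact ⟨ofIsometric ρ' hiso, Q, hQd, hρ', hQi⟩

/-- The Hilbert direct sum of a family of unitary representations. -/
theorem exists_directSum {ι : Type} [DecidableEq ι] (σ : ι → UnitaryRep Γ) :
    ∃ (τ : UnitaryRep Γ) (p : ∀ i, τ.H →ₗ[ℂ] (σ i).H) (s : ∀ i, (σ i).H →ₗ[ℂ] τ.H),
      (∀ v, (∀ i, p i v = 0) → v = 0) ∧ (∀ i v, ‖s i v‖ = ‖v‖) ∧
      (∀ i g v, p i (τ.rep g v) = (σ i).rep g (p i v)) ∧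
      (∀ i g v, τ.rep g (s i v) = s i ((σ i).rep g v)) := by
  let T : Γ → (lp (fun i => (σ i).H) 2 →L[ℂ] lp (fun i => (σ i).H) 2) := fun g =>
    lp.mapCLM 2 (fun i => ((σ i).π g : (σ i).H →L[ℂ] (σ i).H)) zero_le_one fun i =>
      ContinuousLinearMap.opNorm_le_bound _ zero_le_one fun v => by rw [Unitary.norm_map, one_mul]
  have hT : ∀ g v i, T g v i = (σ i).rep g (v i) := fun _ _ _ => rfl
  let ρ : Representation ℂ Γ (lp (fun i => (σ i).H) 2) :=
    { toFun := fun g => (T g : _ →ₗ[ℂ] _)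
      map_one' := by ext v i; simp [hT]
      map_mul' := fun g k => by ext v i; simp [hT] }
  have hρ : ∀ g v i, ρ g v i = (σ i).rep g (v i) := fun _ _ _ => rfl
  have hiso : ∀ g v, ‖ρ g v‖ = ‖v‖ := fun g v => by
    rw [lp.norm_eq_tsum_rpow (by norm_num), lp.norm_eq_tsum_rpow (by norm_num)]
    simp only [hρ, norm_rep]
  let p : ∀ i, lp (fun i => (σ i).H) 2 →ₗ[ℂ] (σ i).H := fun i =>
    { toFun := fun v => v i, map_add' := fun _ _ => rfl, map_smul' := fun _ _ => rfl }
  let s : ∀ i, (σ i).H →ₗ[ℂ] lp (fun i => (σ i).H) 2 :=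
    fun i => lp.lsingle (𝕜 := ℂ) (E := fun i => (σ i).H) 2 i
  have hs : ∀ i v, s i v = lp.single (E := fun i => (σ i).H) 2 i v := fun _ _ => rfl
  have hp : ∀ v, (∀ i, p i v = 0) → v = 0 := fun v hv => lp.ext (funext hv)
  have hsn : ∀ i v, ‖s i v‖ = ‖v‖ := fun i v => by
    rw [hs]
    exact lp.norm_single (E := fun i => (σ i).H) (by norm_num) i v
  have hsg : ∀ i g v, ρ g (s i v) = s i ((σ i).rep g v) := fun i g v => by
    refine lp.ext (funext fun j => ?_)
    rw [hρ, hs, hs]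
    by_cases h : j = i
    · subst h; simp
    · simp [h]
  exact ⟨ofIsometric ρ hiso, p, s, hp, hsn, fun i g v => hρ g v i, hsg⟩

/-- The space of invariant vectors. -/
def inv (σ : UnitaryRep Γ) : Submodule ℂ σ.H where
  carrier := {v | ∀ g, σ.rep g v = v}
  zero_mem' g := map_zero _
  add_mem' {v w} hv hw g := by rw [map_add, hv g, hw g]
  smul_mem' c v hv g := by rw [map_smul, hv g]

lemma mem_inv {σ : UnitaryRep Γ} {v : σ.H} : v ∈ σ.inv ↔ ∀ g, σ.rep g v = v := Iff.rfl

lemma isClosed_inv (σ : UnitaryRep Γ) : IsClosed (σ.inv : Set σ.H) := by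
  have : (σ.inv : Set σ.H) = ⋂ g, {v | σ.rep g v = v} := by ext v; simp [mem_inv]
  rw [this]
  exact isClosed_iInter fun g => isClosed_eq (σ.π g : σ.H →L[ℂ] σ.H).continuous continuous_id

instance (σ : UnitaryRep Γ) : CompleteSpace σ.inv := σ.isClosed_inv.completeSpace_coe

lemma inner_rep (σ : UnitaryRep Γ) (g : Γ) (v w : σ.H) :
    Inner.inner ℂ (σ.rep g v) (σ.rep g w) = Inner.inner ℂ v w :=
  Unitary.inner_map_map (σ.π g) v w

lemma inner_rep_left (σ : UnitaryRep Γ) (g : Γ) (v w : σ.H) :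
    Inner.inner ℂ (σ.rep g v) w = Inner.inner ℂ v (σ.rep g⁻¹ w) := by
  rw [← σ.inner_rep g v]
  congr 1
  simp [← Module.End.mul_apply, ← map_mul]

lemma rep_mem_orthogonal (σ : UnitaryRep Γ) (g : Γ) {v : σ.H} (hv : v ∈ σ.invᗮ) :
    σ.rep g v ∈ σ.invᗮ := by
  rw [Submodule.mem_orthogonal'] at *
  intro u hu
  rw [inner_rep_left, hu, hv u hu]

/-- The subrepresentation on the orthogonal complement of the invariant vectors. -/
def coinv (σ : UnitaryRep Γ) : UnitaryRep Γ :=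
  ofIsometric (H := σ.invᗮ)
    { toFun := fun g => (σ.rep g).restrict fun _ => σ.rep_mem_orthogonal g
      map_one' := by ext v; simp
      map_mul' := fun g k => by ext v; simp }
    fun g v => σ.norm_rep g v

lemma coinv_rep (σ : UnitaryRep Γ) (g : Γ) (v : σ.invᗮ) :
    (show σ.invᗮ from σ.coinv.rep g v : σ.H) = σ.rep g v := rfl

lemma noInvariants_iff {σ : UnitaryRep Γ} :
    σ.NoInvariants ↔ ∀ v : σ.H, (∀ g, σ.rep g v = v) → v = 0 := Iff.rfl

lemma coinv_noInvariants (σ : UnitaryRep Γ) : σ.coinv.NoInvariants := by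
  rw [noInvariants_iff]
  intro (v : σ.invᗮ) hv
  have h1 : (v : σ.H) ∈ σ.inv := fun g => by rw [← coinv_rep, hv g]
  have h2 := Submodule.mem_orthogonal _ _ |>.1 v.2 _ h1
  exact Subtype.ext (inner_self_eq_zero.1 h2)

end UnitaryRep

/-! ### Matrices over an algebra acting on tuples of vectors. -/

section MatAct

variable {R V : Type} [Ring R] [Algebra ℂ R] [AddCommGroup V] [Module ℂ V]
variable {a b c : Type}

/-- A matrix over an algebra acts on tuples of elements of a module. -/
def matAct [Fintype a] (φ : R →ₐ[ℂ] Module.End ℂ V) (M : Matrix b a R) :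
    (a → V) →ₗ[ℂ] (b → V) where
  toFun v j := ∑ i, φ (M j i) (v i)
  map_add' v w := by ext j; simp [Finset.sum_add_distrib]
  map_smul' r v := by ext j; simp [Finset.smul_sum]

lemma matAct_apply [Fintype a] (φ : R →ₐ[ℂ] Module.End ℂ V) (M : Matrix b a R) (v : a → V)
    (j : b) : matAct φ M v j = ∑ i, φ (M j i) (v i) := rfl

lemma matAct_mul [Fintype a] [Fintype b] (φ : R →ₐ[ℂ] Module.End ℂ V) (M : Matrix c b R)
    (N : Matrix b a R) (v : a → V) : matAct φ (M * N) v = matAct φ M (matAct φ N v) := by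
  ext j
  simp only [matAct_apply, Matrix.mul_apply, map_sum, map_mul, LinearMap.sum_apply,
    Module.End.mul_apply]
  exact Finset.sum_comm

lemma matAct_add [Fintype a] (φ : R →ₐ[ℂ] Module.End ℂ V) (M N : Matrix b a R) (v : a → V) :
    matAct φ (M + N) v = matAct φ M v + matAct φ N v := by
  ext j; simp [matAct_apply, Finset.sum_add_distrib]

lemma matAct_sub [Fintype a] (φ : R →ₐ[ℂ] Module.End ℂ V) (M N : Matrix b a R) (v : a → V) :
    matAct φ (M - N) v = matAct φ M v - matAct φ N v := by
  ext j; simp [matAct_apply]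

lemma matAct_smul [Fintype a] (φ : R →ₐ[ℂ] Module.End ℂ V) (r : ℂ) (M : Matrix b a R)
    (v : a → V) : matAct φ (r • M) v = r • matAct φ M v := by
  ext j; simp [matAct_apply, Finset.smul_sum]

lemma matAct_zero [Fintype a] (φ : R →ₐ[ℂ] Module.End ℂ V) (v : a → V) :
    matAct φ (0 : Matrix b a R) v = 0 := by
  ext j; simp [matAct_apply]

lemma matAct_diagonal [Fintype a] [DecidableEq a] (φ : R →ₐ[ℂ] Module.End ℂ V) (d : a → R)
    (v : a → V) (i : a) : matAct φ (Matrix.diagonal d) v i = φ (d i) (v i) := by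
  rw [matAct_apply, Finset.sum_eq_single i]
  · simp
  · intro j _ hj; simp [Matrix.diagonal_apply_ne' _ hj]
  · simp

lemma matAct_one [Fintype a] [DecidableEq a] (φ : R →ₐ[ℂ] Module.End ℂ V) (v : a → V) :
    matAct φ (1 : Matrix a a R) v = v := by
  ext i; rw [← Matrix.diagonal_one, matAct_diagonal]; simp

lemma matAct_fromRows [Fintype a] (φ : R →ₐ[ℂ] Module.End ℂ V) (M : Matrix b a R)
    (N : Matrix c a R) (v : a → V) :
    matAct φ (Matrix.fromRows M N) v = Sum.elim (matAct φ M v) (matAct φ N v) := by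
  ext (j | j) <;> simp [matAct_apply]

lemma matAct_single [Fintype a] [DecidableEq a] (φ : R →ₐ[ℂ] Module.End ℂ V) (M : Matrix b a R)
    (i : a) (u : V) (j : b) : matAct φ M (Pi.single i u) j = φ (M j i) u := by
  rw [matAct_apply, Finset.sum_eq_single i]
  · simp
  · intro k _ hk; simp [hk]
  · simp

lemma continuous_matAct [Fintype a] [TopologicalSpace V] [ContinuousAdd V]
    (φ : R →ₐ[ℂ] Module.End ℂ V) (hφ : ∀ x, Continuous (φ x)) (M : Matrix b a R) :
    Continuous (matAct φ M) :=
  continuous_pi fun _ => continuous_finsetSum _ fun i _ => (hφ _).comp (continuous_apply i)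

end MatAct

section RepAct

variable {Γ V : Type} [Group Γ] [AddCommGroup V] [Module ℂ V]

/-- The action of the group algebra defined by a representation. -/
def repAct (ρ : Representation ℂ Γ V) : GroupAlg Γ →ₐ[ℂ] Module.End ℂ V := ρ.asAlgebraHom

lemma repAct_of (ρ : Representation ℂ Γ V) (g : Γ) : repAct ρ (GroupAlg.of g) = ρ g :=
  Representation.asAlgebraHom_of ρ g

lemma repAct_eq_of {ρ : Representation ℂ Γ V} {φ : GroupAlg Γ →ₐ[ℂ] Module.End ℂ V}
    (h : ∀ g, φ (GroupAlg.of g) = ρ g) : repAct ρ = φ := by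
  ext1 x
  induction x using GroupAlg.induction with
  | h1 g => rw [repAct_of, h]
  | h2 x y hx hy => rw [map_add, map_add, hx, hy]
  | h3 c x hx => rw [map_smul, map_smul, hx]

lemma repAct_of_invariant (ρ : Representation ℂ Γ V) {v : V} (hv : ∀ g, ρ g v = v)
    (x : GroupAlg Γ) : repAct ρ x v = GroupAlg.augmentation x • v := by
  induction x using GroupAlg.induction with
  | h1 g => rw [repAct_of, hv, GroupAlg.augmentation_of, one_smul]
  | h2 x y hx hy => rw [map_add, map_add, LinearMap.add_apply, hx, hy, add_smul]
  | h3 c x hx => rw [map_smul, map_smul, LinearMap.smul_apply, hx, smul_assoc]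

lemma continuous_repAct [TopologicalSpace V] [ContinuousAdd V] [ContinuousConstSMul ℂ V]
    (ρ : Representation ℂ Γ V) (hρ : ∀ g, Continuous (ρ g)) (x : GroupAlg Γ) :
    Continuous (repAct ρ x) := by
  induction x using GroupAlg.induction with
  | h1 g => rw [repAct_of]; exact hρ g
  | h2 x y hx hy => rw [map_add]; exact hx.add hy
  | h3 c x hx => rw [map_smul]; exact hx.const_smul c

lemma repAct_equivariant {W : Type} [AddCommGroup W] [Module ℂ W] {ρ : Representation ℂ Γ V}
    {ρ' : Representation ℂ Γ W} (f : V →ₗ[ℂ] W) (hf : ∀ g v, f (ρ g v) = ρ' g (f v))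
    (x : GroupAlg Γ) (v : V) : f (repAct ρ x v) = repAct ρ' x (f v) := by
  induction x using GroupAlg.induction with
  | h1 g => rw [repAct_of, repAct_of, hf]
  | h2 x y hx hy => simp only [map_add, LinearMap.add_apply, hx, hy]
  | h3 c x hx => simp only [map_smul, LinearMap.smul_apply, hx]

lemma matAct_equivariant {W : Type} [AddCommGroup W] [Module ℂ W] {ρ : Representation ℂ Γ V}
    {ρ' : Representation ℂ Γ W} (f : V →ₗ[ℂ] W) (hf : ∀ g v, f (ρ g v) = ρ' g (f v))
    {a b : Type} [Fintype a] (M : Matrix b a (GroupAlg Γ)) (v : a → V) (j : b) :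
    f (matAct (repAct ρ) M v j) = matAct (repAct ρ') M (fun i => f (v i)) j := by
  simp only [matAct_apply, map_sum, repAct_equivariant f hf]

end RepAct

namespace UnitaryRep

variable {Γ : Type} [Group Γ] {a b c : Type}

lemma repAct_rep (σ : UnitaryRep Γ) (x : GroupAlg Γ) (v : σ.H) :
    repAct σ.rep x v = GroupAlg.act σ x v := by
  induction x using GroupAlg.induction with
  | h1 g => rw [repAct_of, GroupAlg.act_of, rep_apply]
  | h2 x y hx hy =>
    rw [map_add, map_add, LinearMap.add_apply, hx, hy, _root_.add_apply]
  | h3 c x hx => rw [map_smul, map_smul, LinearMap.smul_apply, hx, _root_.smul_apply]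

lemma continuous_rep (σ : UnitaryRep Γ) (g : Γ) : Continuous (σ.rep g) :=
  (σ.π g : σ.H →L[ℂ] σ.H).continuous

lemma norm_repAct_le (σ : UnitaryRep Γ) (x : GroupAlg Γ) (v : σ.H) :
    ‖repAct σ.rep x v‖ ≤ ‖x‖ * ‖v‖ := by
  rw [repAct_rep]
  exact (ContinuousLinearMap.le_opNorm _ _).trans
    (mul_le_mul_of_nonneg_right (GroupAlg.norm_act_le σ x) (norm_nonneg _))

lemma inner_repAct_left (σ : UnitaryRep Γ) (x : GroupAlg Γ) (v w : σ.H) :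
    Inner.inner ℂ (repAct σ.rep x v) w = Inner.inner ℂ v (repAct σ.rep (star x) w) := by
  rw [repAct_rep, repAct_rep, GroupAlg.act_star, ContinuousLinearMap.star_eq_adjoint,
    ContinuousLinearMap.adjoint_inner_right]

/-- The action of matrices over the group algebra on tuples of vectors. -/
abbrev mat [Fintype a] (σ : UnitaryRep Γ) (M : Matrix b a (GroupAlg Γ)) :
    (a → σ.H) →ₗ[ℂ] (b → σ.H) := matAct (repAct σ.rep) M

lemma continuous_mat [Fintype a] (σ : UnitaryRep Γ) (M : Matrix b a (GroupAlg Γ)) :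
    Continuous (σ.mat M) :=
  continuous_matAct _ (continuous_repAct _ σ.continuous_rep) M

/-- The square of the Hilbert space norm of a tuple of vectors. -/
def normSq [Fintype a] {H : Type} [NormedAddCommGroup H] (v : a → H) : ℝ := ∑ i, ‖v i‖ ^ 2

section

variable [Fintype a] [Fintype b] [Fintype c] {H : Type} [NormedAddCommGroup H]

lemma normSq_nonneg (v : a → H) : 0 ≤ normSq v := Finset.sum_nonneg fun _ _ => by positivity

lemma norm_sq_le_normSq (v : a → H) (i : a) : ‖v i‖ ^ 2 ≤ normSq v :=
  Finset.single_le_sum (f := fun i => ‖v i‖ ^ 2) (fun _ _ => by positivity) (Finset.mem_univ i)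

lemma norm_le_sqrt_normSq (v : a → H) (i : a) : ‖v i‖ ≤ √(normSq v) :=
  Real.le_sqrt_of_sq_le (norm_sq_le_normSq v i)

lemma normSq_le_card_mul (v : a → H) : normSq v ≤ Fintype.card a * ‖v‖ ^ 2 := by
  refine (Finset.sum_le_card_nsmul _ _ (‖v‖ ^ 2) fun i _ => ?_).trans_eq ?_
  · gcongr; exact norm_le_pi_norm v i
  · simp

lemma sq_norm_le_normSq (v : a → H) : ‖v‖ ^ 2 ≤ normSq v := by
  refine Real.le_sqrt (norm_nonneg _) (normSq_nonneg v) |>.1 ?_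
  exact (pi_norm_le_iff_of_nonneg (Real.sqrt_nonneg _)).2 (norm_le_sqrt_normSq v)

lemma normSq_eq_zero {v : a → H} (h : normSq v = 0) : v = 0 := by
  ext i
  have := (Finset.sum_eq_zero_iff_of_nonneg fun _ _ => by positivity).1 h i (Finset.mem_univ i)
  simpa using this

lemma normSq_smul [NormedSpace ℂ H] (r : ℂ) (v : a → H) : normSq (r • v) = ‖r‖ ^ 2 * normSq v := by
  simp [normSq, norm_smul, mul_pow, Finset.mul_sum]

lemma normSq_single [DecidableEq a] (i : a) (u : H) : normSq (Pi.single i u) = ‖u‖ ^ 2 := by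
  rw [normSq, Finset.sum_eq_single i]
  · simp
  · intro j _ hj; simp [hj]
  · simp

/-- A bound for the action of a matrix in all unitary representations. -/
def matBound (M : Matrix b a (GroupAlg Γ)) : ℝ := ∑ j, (∑ i, ‖M j i‖) ^ 2

/-- The estimate is crude, bounding each `‖v i‖` by the norm of the whole tuple. What matters is
that the constant does not depend on `σ`. -/
lemma normSq_mat_le (σ : UnitaryRep Γ) (M : Matrix b a (GroupAlg Γ)) (v : a → σ.H) :
    normSq (σ.mat M v) ≤ matBound M * normSq v := by
  rw [normSq, matBound, Finset.sum_mul]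
  refine Finset.sum_le_sum fun j _ => ?_
  rw [← Real.sq_sqrt (normSq_nonneg v), ← mul_pow]
  refine pow_le_pow_left₀ (norm_nonneg _) ?_ 2
  rw [matAct_apply, Finset.sum_mul]
  refine (norm_sum_le _ _).trans (Finset.sum_le_sum fun i _ => ?_)
  exact (σ.norm_repAct_le _ _).trans
    (mul_le_mul_of_nonneg_left (norm_le_sqrt_normSq v i) (norm_nonneg _))

open Matrix in
lemma sum_inner_mat_left (σ : UnitaryRep Γ) (M : Matrix b a (GroupAlg Γ)) (v : a → σ.H)
    (w : b → σ.H) :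
    ∑ j, Inner.inner ℂ (σ.mat M v j) (w j) = ∑ i, Inner.inner ℂ (v i) (σ.mat Mᴴ w i) := by
  simp only [matAct_apply, sum_inner, inner_sum, inner_repAct_left, conjTranspose_apply]
  exact Finset.sum_comm

lemma sum_inner_self [InnerProductSpace ℂ H] (v : a → H) :
    ∑ i, Inner.inner ℂ (v i) (v i) = (normSq v : ℂ) := by
  simp [normSq, inner_self_eq_norm_sq_to_K]

end

lemma repAct_coinv (σ : UnitaryRep Γ) (x : GroupAlg Γ) (v : σ.invᗮ) :
    repAct σ.rep x (v : σ.H) = (show σ.invᗮ from repAct σ.coinv.rep x v) :=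
  (repAct_equivariant (ρ := σ.coinv.rep) (σ.invᗮ.subtype) (fun g v => σ.coinv_rep g v) x v).symm

end UnitaryRep

/-! ### Uniform estimates over representations without invariant vectors. -/

namespace GroupAlg

variable {Γ : Type} [Group Γ]

/-- An element of the augmentation ideal is bounded by its action in the unitary representations
without invariant vectors. -/
theorem norm_le_of_noInvariants {x : GroupAlg Γ} (hx : augmentation x = 0) {r : ℝ} (hr : 0 ≤ r)
    (h : ∀ σ : UnitaryRep Γ, σ.NoInvariants → ∀ v, ‖repAct σ.rep x v‖ ≤ r * ‖v‖) : ‖x‖ ≤ r := by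
  rw [norm_def]
  refine ciSup_le fun σ => ContinuousLinearMap.opNorm_le_bound _ hr fun v => ?_
  have hv := Submodule.starProjection_add_starProjection_orthogonal (K := σ.inv) v
  -- On invariant vectors `x` acts by its augmentation, which is zero, so only the complement
  -- contributes to the norm.
  have h1 : repAct σ.rep x (σ.inv.starProjection v) = 0 := by
    rw [repAct_of_invariant _ (Submodule.starProjection_apply_mem σ.inv v), hx, zero_smul]
  rw [← UnitaryRep.repAct_rep]
  nth_rewrite 1 [← hv]
  rw [map_add, h1, zero_add]
  have h2 : σ.invᗮ.starProjection v ∈ σ.invᗮ := Submodule.starProjection_apply_mem _ v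
  rw [σ.repAct_coinv x ⟨_, h2⟩]
  refine (h _ σ.coinv_noInvariants ⟨_, h2⟩).trans ?_
  exact mul_le_mul_of_nonneg_left (Submodule.norm_starProjection_apply_le _ v) hr

end GroupAlg

namespace UnitaryRep

variable {Γ : Type} [Group Γ] {b c : Type} [Fintype b] [Fintype c]

/-- If a matrix over the group algebra acts injectively and with closed range on all unitary
representations without invariant vectors, then it is bounded below uniformly. -/
theorem exists_uniform_bound_of_isClosed_range (D : Matrix c b (GroupAlg Γ))
    (h : ∀ σ : UnitaryRep Γ, σ.NoInvariants →
      Function.Injective (σ.mat D) ∧ IsClosed (Set.range (σ.mat D))) :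
    ∃ C : ℝ, ∀ σ : UnitaryRep Γ, σ.NoInvariants → ∀ v, normSq v ≤ C * normSq (σ.mat D v) := by
  by_contra! hcon
  choose σ hσ v hv using fun n : ℕ => hcon n
  -- All counterexamples live in one Hilbert sum, which again has no invariant vectors. The open
  -- mapping theorem there gives one constant for all of them.
  obtain ⟨τ, p, s, hp, hs, hpg, hsg⟩ := exists_directSum σ
  have hτ : τ.NoInvariants := noInvariants_iff.2 fun v hv => hp v fun i =>
    noInvariants_iff.1 (hσ i) _ fun g => by rw [← hpg, hv]
  obtain ⟨hinj, hcl⟩ := h τ hτ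
  let T : (b → τ.H) →L[ℂ] (c → τ.H) := ⟨τ.mat D, τ.continuous_mat D⟩
  obtain ⟨K, hK⟩ := T.antilipschitz_of_injective_of_isClosed_range hinj hcl
  have hK' : ∀ w, ‖w‖ ≤ K * ‖τ.mat D w‖ := fun w => by
    have := hK.le_mul_dist w 0
    rwa [map_zero, dist_zero_right, dist_zero_right] at this
  -- The factor `card b` is the price of passing from the supremum norm on tuples to `normSq`.
  obtain ⟨n, hn⟩ := exists_nat_ge (Fintype.card b * (K : ℝ) ^ 2)
  have h1 : ∀ {a : Type} [Fintype a] (w : a → (σ n).H),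
      normSq (fun i => s n (w i)) = normSq w := fun w => by simp [normSq, hs]
  have h2 : τ.mat D (fun i => s n (v n i)) = fun j => s n ((σ n).mat D (v n) j) := by
    ext j
    exact (matAct_equivariant (s n) (fun g v => (hsg n g v).symm) D (v n) j).symm
  have h3 := (normSq_le_card_mul _).trans
    (mul_le_mul_of_nonneg_left (pow_le_pow_left₀ (norm_nonneg _)
      (hK' (fun i => s n (v n i))) 2) (Nat.cast_nonneg _))
  rw [h1, h2, mul_pow, ← mul_assoc] at h3
  have h4 := sq_norm_le_normSq (fun j => s n ((σ n).mat D (v n) j))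
  rw [h1] at h4
  have h5 := hv n
  have h6 : Fintype.card b * (K : ℝ) ^ 2 * ‖fun j => s n ((σ n).mat D (v n) j)‖ ^ 2 ≤
      n * normSq ((σ n).mat D (v n)) := mul_le_mul hn h4 (by positivity) (by positivity)
  linarith

end UnitaryRep

/-! ### Ultraproducts and lower bounds for the Laplacian. -/

namespace UnitaryRep

open Filter Topology Matrix

variable {Γ : Type} [Group Γ]

/-- The Hilbert space ultraproduct of unitary representations, restricted to the closure of the
image of a representation `E` that maps to all of them. -/
theorem exists_ultraproduct (σ : ℕ → UnitaryRep Γ) {E : Type} [AddCommGroup E] [Module ℂ E]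
    (ρ : Representation ℂ Γ E) (L : ∀ n, E →ₗ[ℂ] (σ n).H)
    (hL : ∀ n g x, L n (ρ g x) = (σ n).rep g (L n x)) (hb : ∀ x, ∃ r, ∀ n, ‖L n x‖ ≤ r) :
    ∃ (τ : UnitaryRep Γ) (Q : E →ₗ[ℂ] τ.H), DenseRange Q ∧
      (∀ g x, Q (ρ g x) = τ.rep g (Q x)) ∧
      ∀ x, Tendsto (fun n => ‖L n x‖ ^ 2) (hyperfilter ℕ) (𝓝 (‖Q x‖ ^ 2)) := by
  -- Bounded inner products stay in a compact disc, so they converge along the ultrafilter. The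
  -- limits form a semidefinite invariant form on `E`, and Hausdorff completion removes its null
  -- vectors.
  have hlim : ∀ x y, ∃ z, Tendsto (fun n => Inner.inner ℂ (L n x) (L n y)) (hyperfilter ℕ)
      (𝓝 z) := fun x y => by
    obtain ⟨r, hr⟩ := hb x
    obtain ⟨s, hs⟩ := hb y
    have hmem : ∀ n, Inner.inner ℂ (L n x) (L n y) ∈ Metric.closedBall (0 : ℂ) (r * s) := fun n => by
      rw [mem_closedBall_zero_iff]
      exact (norm_inner_le_norm _ _).trans (mul_le_mul (hr n) (hs n) (norm_nonneg _)
        ((norm_nonneg _).trans (hr n)))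
    obtain ⟨z, -, hz⟩ := (isCompact_closedBall (0 : ℂ) (r * s)).ultrafilter_le_nhds
      ((hyperfilter ℕ).map fun n => Inner.inner ℂ (L n x) (L n y))
      (by
        rw [le_principal_iff, Ultrafilter.mem_coe, Ultrafilter.mem_map]
        exact Filter.mem_of_superset univ_mem fun n _ => hmem n)
    exact ⟨z, hz⟩
  choose B hB using hlim
  let c : PreInnerProductSpace.Core ℂ E :=
    { inner := B
      conj_inner_symm := fun x y => by
        refine tendsto_nhds_unique ((Complex.continuous_conj.tendsto _).comp (hB y x)) ?_
        refine (hB x y).congr fun n => ?_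
        simp
      re_inner_nonneg := fun x => by
        refine ge_of_tendsto' ((Complex.continuous_re.tendsto _).comp (hB x x)) fun n => ?_
        exact inner_self_nonneg (𝕜 := ℂ) (x := L n x)
      add_left := fun x y z => by
        refine tendsto_nhds_unique (hB (x + y) z) ?_
        refine ((hB x z).add (hB y z)).congr fun n => ?_
        rw [map_add, inner_add_left]
      smul_left := fun x y r => by
        refine tendsto_nhds_unique (hB (r • x) y) ?_
        refine ((hB x y).const_mul (starRingEnd ℂ r)).congr fun n => ?_
        rw [map_smul, inner_smul_left] }
  obtain ⟨τ, Q, hQ, hg, hi⟩ := exists_completion ρ c fun g x y => by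
    refine tendsto_nhds_unique (hB _ _) ((hB x y).congr fun n => ?_)
    rw [hL, hL, inner_rep]
  refine ⟨τ, Q, hQ, fun g x => (hg g x).symm, fun x => ?_⟩
  have h1 := (Complex.continuous_re.tendsto _).comp (hB x x)
  have h2 : (B x x).re = ‖Q x‖ ^ 2 := by
    rw [show B x x = Inner.inner ℂ (Q x) (Q x) from (hi x x).symm]
    exact inner_self_eq_norm_sq (𝕜 := ℂ) (Q x)
  rw [h2] at h1
  refine h1.congr fun n => ?_
  exact inner_self_eq_norm_sq (𝕜 := ℂ) (L n x)

variable {a b c d : Type} [Fintype a] [Fintype b] [Fintype c] [Fintype d]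

/-- A matrix over the group algebra is bounded below uniformly on the unitary representations
without invariant vectors. -/
def BoundedBelow (B : Matrix c b (GroupAlg Γ)) : Prop :=
  ∃ C : ℝ, ∀ σ : UnitaryRep Γ, σ.NoInvariants → ∀ v, normSq v ≤ C * normSq (σ.mat B v)

/-- If a matrix acts injectively and with closed range on all unitary representations without
invariant vectors, but not injectively on the trivial representation, then there is a column over
the augmentation ideal that is bounded below. -/
theorem exists_column_boundedBelow (D : Matrix c b (GroupAlg Γ))
    (h : ∀ σ : UnitaryRep Γ, σ.NoInvariants →
      Function.Injective (σ.mat D) ∧ IsClosed (Set.range (σ.mat D)))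
    {ε : b → ℂ} (hε : ε ≠ 0) (hD : ∀ j, ∑ i, GroupAlg.augmentation (D j i) * ε i = 0) :
    ∃ Y : Matrix c Unit (GroupAlg Γ), (∀ j i, GroupAlg.augmentation (Y j i) = 0) ∧
      BoundedBelow Y := by
  obtain ⟨C, hC⟩ := exists_uniform_bound_of_isClosed_range D h
  have hε' : 0 < normSq ε := lt_of_le_of_ne (normSq_nonneg _) fun h => hε (normSq_eq_zero h.symm)
  -- The column is `D ε`. Its augmentation vanishes by the choice of `ε`, and applying it to `u` is
  -- applying `D` to the tuple `ε i • u`, of square norm `normSq ε * normSq u`.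
  refine ⟨fun j _ => ∑ i, ε i • D j i, fun j _ => ?_, C / normSq ε, fun σ hσ u => ?_⟩
  · rw [map_sum, ← hD j]
    exact Finset.sum_congr rfl fun i _ => by rw [map_smul, smul_eq_mul, mul_comm]
  · have h1 := hC σ hσ fun i => ε i • u ()
    have h2 : σ.mat D (fun i => ε i • u ()) =
        σ.mat (fun j _ => ∑ i, ε i • D j i : Matrix c Unit (GroupAlg Γ)) u := by
      ext j
      change ∑ i, repAct σ.rep (D j i) (ε i • u ()) =
        ∑ k : Unit, repAct σ.rep (∑ i, ε i • D j i) (u k)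
      simp
    have h3 : normSq (fun i => ε i • u ()) = normSq ε * normSq u := by
      simp [normSq, norm_smul, mul_pow, Finset.sum_mul]
    rw [h2, h3] at h1
    rw [div_mul_eq_mul_div, le_div_iff₀ hε', mul_comm]
    exact h1

/-- A column over the augmentation ideal kills invariant vectors, so a lower bound forces them to be
zero. This is how the absence of invariant vectors passes to an ultraproduct. -/
lemma noInvariants_of_column {Y : Matrix c Unit (GroupAlg Γ)}
    (hY : ∀ j i, GroupAlg.augmentation (Y j i) = 0) {τ : UnitaryRep Γ} {C : ℝ}
    (h : ∀ v, normSq v ≤ C * normSq (τ.mat Y v)) : τ.NoInvariants := by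
  rw [noInvariants_iff]
  intro v hv
  have h1 : τ.mat Y (fun _ => v) = 0 := by
    ext j
    simp [matAct_apply, repAct_of_invariant _ hv, hY]
  have h2 := h fun _ => v
  rw [h1] at h2
  simpa [normSq] using h2

/-- If the complex given by two matrices is exact in all unitary representations without invariant
vectors, then its Laplacian is bounded below. -/
theorem boundedBelow_of_exact [DecidableEq b] {Y : Matrix d Unit (GroupAlg Γ)}
    (hY : ∀ j i, GroupAlg.augmentation (Y j i) = 0) (hYb : BoundedBelow Y)
    (D : Matrix b a (GroupAlg Γ)) (D' : Matrix c b (GroupAlg Γ))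
    (hex : ∀ σ : UnitaryRep Γ, σ.NoInvariants → ∀ v, σ.mat D' v = 0 → ∃ u, σ.mat D u = v) :
    BoundedBelow (fromRows D' Dᴴ) := by
  by_contra hcon
  unfold BoundedBelow at hcon
  push Not at hcon
  obtain ⟨C, hC⟩ := hYb
  choose σ hσ v hv using fun n : ℕ => hcon n
  have hpos : ∀ n, 0 < normSq (v n) := fun n =>
    lt_of_le_of_lt (mul_nonneg (Nat.cast_nonneg _) (normSq_nonneg _)) (hv n)
  have hnorm : ∀ n, ∃ w : b → (σ n).H, normSq w = 1 ∧
      n * normSq ((σ n).mat (fromRows D' Dᴴ) w) ≤ 1 := fun n => by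
    have h0 : ‖(((√(normSq (v n)))⁻¹ : ℝ) : ℂ)‖ ^ 2 = (normSq (v n))⁻¹ := by
      rw [Complex.norm_real, Real.norm_eq_abs, sq_abs, inv_pow, Real.sq_sqrt (hpos n).le]
    refine ⟨(((√(normSq (v n)))⁻¹ : ℝ) : ℂ) • v n, ?_, ?_⟩
    · rw [normSq_smul, h0, inv_mul_cancel₀ (hpos n).ne']
    · rw [map_smul, normSq_smul, h0, mul_left_comm, inv_mul_le_iff₀ (hpos n), mul_one]
      exact (hv n).le
  choose w hw1 hw2 using hnorm
  -- The free module on `b` maps to each `(σ n).H` by sending its basis to the almost harmonic tuple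
  -- `w n`. Hence the limit contains just the subrepresentation generated by the limit tuple.
  let ρ : Representation ℂ Γ (b → GroupAlg Γ) :=
    { toFun := fun g =>
        { toFun := fun x i => GroupAlg.of g * x i
          map_add' := fun x y => by ext i; simp [mul_add]
          map_smul' := fun r x => by ext i; simp }
      map_one' := by ext x i; simp
      map_mul' := fun g k => by ext x i; simp [mul_assoc] }
  have hρ : ∀ g x i, ρ g x i = GroupAlg.of g * x i := fun _ _ _ => rfl
  let L : ∀ n, (b → GroupAlg Γ) →ₗ[ℂ] (σ n).H := fun n =>
    { toFun := fun x => ∑ i, repAct (σ n).rep (x i) (w n i)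
      map_add' := fun x y => by simp [Finset.sum_add_distrib]
      map_smul' := fun r x => by simp [Finset.smul_sum] }
  have hL : ∀ n x, L n x = ∑ i, repAct (σ n).rep (x i) (w n i) := fun _ _ => rfl
  have hLg : ∀ n g x, L n (ρ g x) = (σ n).rep g (L n x) := fun n g x => by
    simp only [hL, hρ, map_mul, repAct_of, map_sum, Module.End.mul_apply]
  obtain ⟨τ, Q, hQd, hQg, hQ⟩ := exists_ultraproduct σ ρ L hLg fun x =>
    ⟨∑ i, ‖x i‖, fun n => by
      rw [hL]
      refine (norm_sum_le _ _).trans (Finset.sum_le_sum fun i _ => ?_)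
      have h1 : ‖w n i‖ ≤ 1 := by
        have := norm_le_sqrt_normSq (w n) i
        rwa [hw1, Real.sqrt_one] at this
      exact ((σ n).norm_repAct_le _ _).trans (mul_le_of_le_one_right (norm_nonneg _) h1)⟩
  have hlim : ∀ {e : Type} [Fintype e] (x : e → b → GroupAlg Γ),
      Tendsto (fun n => normSq fun j => L n (x j)) (hyperfilter ℕ)
        (𝓝 (normSq fun j => Q (x j))) := fun x => tendsto_finsetSum _ fun j _ => hQ (x j)
  let e : b → b → GroupAlg Γ := fun i => Pi.single i 1
  have he : ∀ n i, L n (e i) = w n i := fun n i => by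
    rw [hL, Finset.sum_eq_single i]
    · simp [e]
    · intro j _ hj; simp [e, hj]
    · simp
  have hmat : ∀ {f : Type} [Fintype f] (M : Matrix f b (GroupAlg Γ)),
      Tendsto (fun n => normSq ((σ n).mat M (w n))) (hyperfilter ℕ)
        (𝓝 (normSq (τ.mat M fun i => Q (e i)))) := fun M => by
    have h1 := hlim (matAct (repAct ρ) M e)
    have h2 : (fun j => Q (matAct (repAct ρ) M e j)) = τ.mat M fun i => Q (e i) :=
      funext (matAct_equivariant Q hQg M e)
    rw [h2] at h1
    refine h1.congr fun n => ?_
    have h3 : (fun j => L n (matAct (repAct ρ) M e j)) = (σ n).mat M fun i => L n (e i) :=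
      funext (matAct_equivariant (L n) (hLg n) M e)
    rw [h3]
    simp only [he]
  -- The lower bound of `Y` is uniform in `n`, so it survives in the limit on the dense image of
  -- `Q`, and by continuity on all of `τ`.
  have hτ : τ.NoInvariants := by
    refine noInvariants_of_column hY (C := C) fun u => ?_
    have hcl : IsClosed {z : τ.H | ‖z‖ ^ 2 ≤ C * normSq (τ.mat Y fun _ => z)} := by
      refine isClosed_le (by fun_prop) (continuous_const.mul ?_)
      refine continuous_finsetSum _ fun j _ => Continuous.pow (Continuous.norm ?_) 2
      exact (continuous_apply j).comp
        ((τ.continuous_mat Y).comp (continuous_pi fun _ => continuous_id))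
    have hall : ∀ z : τ.H, ‖z‖ ^ 2 ≤ C * normSq (τ.mat Y fun _ => z) := fun z => by
      refine hQd.induction_on (p := fun z => ‖z‖ ^ 2 ≤ C * normSq (τ.mat Y fun _ => z)) z hcl
        fun x => ?_
      have h1 := hlim (matAct (repAct ρ) Y fun _ => x)
      rw [show (fun j => Q (matAct (repAct ρ) Y (fun _ => x) j)) = τ.mat Y fun _ => Q x from
        funext (matAct_equivariant Q hQg Y fun _ => x)] at h1
      refine le_of_tendsto_of_tendsto' (hQ x) (h1.const_mul C) fun n => ?_
      rw [show (fun j => L n (matAct (repAct ρ) Y (fun _ => x) j)) =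
        (σ n).mat Y fun _ => L n x from
        funext (matAct_equivariant (L n) (hLg n) Y fun _ => x)]
      have := hC (σ n) (hσ n) fun _ => L n x
      simpa [normSq] using this
    have := hall (u ())
    simpa [normSq] using this
  have h1 : normSq (fun i => Q (e i)) = 1 := by
    refine tendsto_nhds_unique (hlim e) ?_
    simp only [he, hw1]
    exact tendsto_const_nhds
  have h2 : τ.mat (fromRows D' Dᴴ) (fun i => Q (e i)) = 0 := by
    refine normSq_eq_zero (tendsto_nhds_unique (hmat _) ?_)
    have h3 : Tendsto (fun n : ℕ => 1 / ((n : ℝ))) (hyperfilter ℕ) (𝓝 0) :=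
      tendsto_one_div_atTop_nhds_zero_nat.mono_left Nat.hyperfilter_le_atTop
    have h4 : ∀ᶠ n : ℕ in hyperfilter ℕ, 0 < n :=
      Nat.hyperfilter_le_atTop (eventually_gt_atTop 0)
    refine tendsto_of_tendsto_of_tendsto_of_le_of_le' tendsto_const_nhds h3
      (Eventually.of_forall fun n => normSq_nonneg _) (h4.mono fun n hn => ?_)
    rw [le_div_iff₀ (by exact_mod_cast hn), mul_comm]
    exact hw2 n
  rw [mat, matAct_fromRows] at h2
  have h5 : τ.mat D' (fun i => Q (e i)) = 0 := funext fun j => congrFun h2 (Sum.inl j)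
  have h6 : τ.mat Dᴴ (fun i => Q (e i)) = 0 := funext fun j => congrFun h2 (Sum.inr j)
  -- The limit tuple `w` is killed by `D'` and `Dᴴ`. Exactness gives `w = D u`, so `⟨w, w⟩ = ⟨u, Dᴴ
  -- w⟩ = 0`, although `w` has norm one.
  obtain ⟨u, hu⟩ := hex τ hτ _ h5
  have h7 := sum_inner_mat_left τ D u fun i => Q (e i)
  rw [hu, h6, sum_inner_self, h1] at h7
  simp at h7

/-- The Laplacian of a matrix that is bounded below can be inverted by a Neumann series. -/
theorem BoundedBelow.exists_contraction [DecidableEq b] {B : Matrix c b (GroupAlg Γ)}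
    (hB : BoundedBelow B) : ∃ (κ q : ℝ), 0 < κ ∧ 0 ≤ q ∧ q < 1 ∧
      ∀ σ : UnitaryRep Γ, σ.NoInvariants → ∀ v,
        normSq (σ.mat (1 - (κ : ℂ) • (Bᴴ * B)) v) ≤ q ^ 2 * normSq v := by
  obtain ⟨C, hC⟩ := hB
  -- Both constants are enlarged to be at least 1, which puts `1 - M⁻¹ * C'⁻¹` in `[0, 1)`.
  obtain ⟨M, hM1, hM⟩ : ∃ M : ℝ, 1 ≤ M ∧ matBound Bᴴ ≤ M := ⟨_, le_max_left _ _, le_max_right _ _⟩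
  obtain ⟨C', hC1, hC'⟩ : ∃ C' : ℝ, 1 ≤ C' ∧ C ≤ C' := ⟨_, le_max_left _ _, le_max_right _ _⟩
  have hM0 : 0 < M := by linarith
  have hC0 : 0 < C' := by linarith
  have hMC : 0 < M⁻¹ * C'⁻¹ := by positivity
  have hMC1 : M⁻¹ * C'⁻¹ ≤ 1 := mul_le_one₀ (inv_le_one_of_one_le₀ hM1) (by positivity)
    (inv_le_one_of_one_le₀ hC1)
  refine ⟨M⁻¹, √(1 - M⁻¹ * C'⁻¹), by positivity, Real.sqrt_nonneg _, ?_, fun σ hσ v => ?_⟩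
  · rw [Real.sqrt_lt' one_pos]; linarith
  rw [Real.sq_sqrt (by linarith), mat, matAct_sub, matAct_one, matAct_smul, matAct_mul]
  -- With `κ = M⁻¹` the quadratic term is at most `κ ‖B v‖²`, which uses up half of the linear term.
  -- The remaining `-κ ‖B v‖²` is at most `-κ C'⁻¹ ‖v‖²`.
  have h1 : normSq (v - ((M⁻¹ : ℝ) : ℂ) • σ.mat Bᴴ (σ.mat B v)) =
      normSq v - 2 * M⁻¹ * normSq (σ.mat B v) + M⁻¹ ^ 2 * normSq (σ.mat Bᴴ (σ.mat B v)) := by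
    have h2 : ∀ i, ‖(v - ((M⁻¹ : ℝ) : ℂ) • σ.mat Bᴴ (σ.mat B v)) i‖ ^ 2 = ‖v i‖ ^ 2 -
        2 * M⁻¹ * (Inner.inner ℂ (v i) (σ.mat Bᴴ (σ.mat B v) i)).re +
        M⁻¹ ^ 2 * ‖σ.mat Bᴴ (σ.mat B v) i‖ ^ 2 := fun i => by
      rw [Pi.sub_apply, Pi.smul_apply, @norm_sub_sq ℂ, inner_smul_right, norm_smul, mul_pow,
        Complex.norm_real, Real.norm_eq_abs, sq_abs]
      congr 2
      rw [mul_assoc 2]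
      congr 1
      exact Complex.re_ofReal_mul _ _
    have h3 := congrArg Complex.re (sum_inner_mat_left σ B v (σ.mat B v))
    rw [sum_inner_self, Complex.ofReal_re, Complex.re_sum] at h3
    rw [normSq, Finset.sum_congr rfl fun i _ => h2 i, Finset.sum_add_distrib,
      Finset.sum_sub_distrib, ← Finset.mul_sum, ← Finset.mul_sum, ← h3]
    rfl
  rw [h1]
  have h4 : normSq (σ.mat Bᴴ (σ.mat B v)) ≤ M * normSq (σ.mat B v) :=
    (σ.normSq_mat_le Bᴴ _).trans (mul_le_mul_of_nonneg_right hM (normSq_nonneg _))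
  have h5 : normSq v ≤ C' * normSq (σ.mat B v) :=
    (hC σ hσ v).trans (mul_le_mul_of_nonneg_right hC' (normSq_nonneg _))
  have h6 : M⁻¹ ^ 2 * normSq (σ.mat Bᴴ (σ.mat B v)) ≤ M⁻¹ * normSq (σ.mat B v) := by
    refine (mul_le_mul_of_nonneg_left h4 (by positivity)).trans_eq ?_
    field_simp
  have h7 : M⁻¹ * C'⁻¹ * normSq v ≤ M⁻¹ * normSq (σ.mat B v) := by
    rw [mul_assoc]
    refine mul_le_mul_of_nonneg_left ?_ (by positivity)
    rw [inv_mul_le_iff₀ hC0]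
    exact h5
  linarith

lemma normSq_mat_pow_le [DecidableEq b] {T : Matrix b b (GroupAlg Γ)} {q : ℝ}
    {σ : UnitaryRep Γ} (hT : ∀ v, normSq (σ.mat T v) ≤ q ^ 2 * normSq v) (m : ℕ) (v : b → σ.H) :
    normSq (σ.mat (T ^ m) v) ≤ (q ^ m) ^ 2 * normSq v := by
  induction m with
  | zero => simp [matAct_one]
  | succ m ih =>
    rw [pow_succ', mat, matAct_mul]
    refine (hT _).trans ((mul_le_mul_of_nonneg_left ih (by positivity)).trans_eq ?_)
    ring

lemma norm_repAct_pow_le [DecidableEq b] {T : Matrix b b (GroupAlg Γ)} {q : ℝ} (hq : 0 ≤ q)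
    {σ : UnitaryRep Γ} (hT : ∀ v, normSq (σ.mat T v) ≤ q ^ 2 * normSq v) (m : ℕ) (i j : b)
    (u : σ.H) : ‖repAct σ.rep ((T ^ m) i j) u‖ ≤ q ^ m * ‖u‖ := by
  have h1 := normSq_mat_pow_le hT m (Pi.single j u)
  rw [normSq_single, ← mul_pow] at h1
  have h2 := (norm_sq_le_normSq _ i).trans h1
  rw [mat, matAct_single] at h2
  exact le_of_sq_le_sq h2 (by positivity)

end UnitaryRep

/-! ### The Kazhdan projection and homotopies on its complement. -/

namespace MaxCStar

open Filter Topology Matrix UniformSpace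

variable {Γ : Type} [Group Γ]

/-- The canonical map from the group algebra to the maximal C⋆-algebra. -/
def coeHom : GroupAlg Γ →ₐ[ℂ] MaxCStar Γ where
  __ := (Completion.coeRingHom : GroupAlg Γ →+* MaxCStar Γ)
  commutes' _ := rfl

lemma coeHom_apply (x : GroupAlg Γ) : coeHom x = (x : MaxCStar Γ) := rfl

lemma coeHom_of (g : Γ) : coeHom (GroupAlg.of g) = of g := rfl

lemma norm_coeHom (x : GroupAlg Γ) : ‖coeHom x‖ = ‖x‖ := Completion.norm_coe x

lemma continuous_augmentation : Continuous (augmentation : MaxCStar Γ → ℂ) :=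
  Completion.continuous_extension

lemma augmentation_coeHom (x : GroupAlg Γ) :
    augmentation (coeHom x) = GroupAlg.augmentation x :=
  Completion.extensionHom_coe (GroupAlg.augmentation : GroupAlg Γ →ₐ[ℂ] ℂ).toRingHom
    GroupAlg.continuous_augmentation x

lemma induction_coeHom {P : MaxCStar Γ → Prop} (hP : IsClosed {a | P a})
    (h : ∀ x, P (coeHom x)) (a : MaxCStar Γ) : P a := Completion.induction_on a hP h

/-- The image of a matrix over the group algebra in the matrices over the maximal C⋆-algebra. -/
abbrev mapMat {a b : Type} (M : Matrix b a (GroupAlg Γ)) : Matrix b a (MaxCStar Γ) :=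
  M.map coeHom

/-- The scalar matrix given by an element of the maximal C⋆-algebra. -/
abbrev scal (a : Type) [DecidableEq a] (x : MaxCStar Γ) : Matrix a a (MaxCStar Γ) :=
  diagonal fun _ => x

/-- A complex matrix as a matrix over the maximal C⋆-algebra. -/
abbrev ofComplex (Γ : Type) [Group Γ] {a b : Type} (M : Matrix b a ℂ) : Matrix b a (MaxCStar Γ) :=
  M.map (algebraMap ℂ (MaxCStar Γ))

lemma ofComplex_mul {a b c : Type} [Fintype b] (M : Matrix c b ℂ) (N : Matrix b a ℂ) :
    ofComplex Γ (M * N) = ofComplex Γ M * ofComplex Γ N := Matrix.map_mul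

lemma mapMat_mul {a b c : Type} [Fintype b] (M : Matrix c b (GroupAlg Γ))
    (N : Matrix b a (GroupAlg Γ)) : mapMat (M * N) = mapMat M * mapMat N :=
  Matrix.map_mul (f := (coeHom (Γ := Γ)).toRingHom)

/-- A Kazhdan projection: it projects to the invariant vectors. -/
structure IsKazhdanProjection (p : MaxCStar Γ) : Prop where
  augmentation : MaxCStar.augmentation p = 1
  mul_right : ∀ a, a * p = MaxCStar.augmentation a • p
  mul_left : ∀ a, p * a = MaxCStar.augmentation a • p
  norm_le : ∀ (x : GroupAlg Γ) (r : ℝ), 0 ≤ r →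
    (∀ σ : UnitaryRep Γ, σ.NoInvariants → ∀ v, ‖repAct σ.rep x v‖ ≤ r * ‖v‖) →
    ‖coeHom x * (1 - p)‖ ≤ 2 * r

/-- A spectral gap of a column over the augmentation ideal yields a Kazhdan projection. -/
theorem exists_isKazhdanProjection {c : Type} [Fintype c] {Y : Matrix c Unit (GroupAlg Γ)}
    (hY : ∀ j i, GroupAlg.augmentation (Y j i) = 0) (hYb : UnitaryRep.BoundedBelow Y) :
    ∃ p : MaxCStar Γ, IsKazhdanProjection p := by
  obtain ⟨κ, q, -, hq0, hq1, hT⟩ := hYb.exists_contraction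
  set T := 1 - (κ : ℂ) • (Yᴴ * Y)
  let l : ℕ → GroupAlg Γ := fun m => (T ^ m) () ()
  have hl : ∀ m σ, UnitaryRep.NoInvariants σ → ∀ v, ‖repAct σ.rep (l m) v‖ ≤ q ^ m * ‖v‖ :=
    fun m σ hσ v => UnitaryRep.norm_repAct_pow_le hq0 (hT σ hσ) m () () v
  have haug : ∀ m, GroupAlg.augmentation (l m) = 1 := fun m => by
    have h1 : (GroupAlg.augmentation (Γ := Γ)).mapMatrix T = 1 := by
      rw [map_sub, map_one, map_smul,
        show GroupAlg.augmentation.mapMatrix (Yᴴ * Y) = 0 from ?_, smul_zero, sub_zero]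
      ext i j
      simp [Matrix.mul_apply, hY]
    have h2 := congrFun (congrFun (map_pow (GroupAlg.augmentation (Γ := Γ)).mapMatrix T m) ()) ()
    rw [h1, one_pow] at h2
    exact h2
  have hq : ∀ m, q ^ m ≤ 1 := fun m => pow_le_one₀ hq0 hq1.le
  have hqt : Tendsto (fun m => q ^ m) atTop (𝓝 0) := tendsto_pow_atTop_nhds_zero_of_lt_one hq0 hq1
  have hcauchy : CauchySeq fun m => coeHom (l m) := by
    refine cauchySeq_of_le_geometric q 2 hq1 fun m => ?_
    rw [dist_eq_norm, ← map_sub, norm_coeHom]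
    -- Every power has augmentation 1, so differences lie in the augmentation ideal. Their norm is
    -- then seen on representations without invariant vectors, where the powers decay geometrically.
    refine GroupAlg.norm_le_of_noInvariants (by rw [map_sub, haug, haug, sub_self])
      (by positivity) fun σ hσ v => ?_
    rw [map_sub, LinearMap.sub_apply]
    refine (norm_sub_le _ _).trans ((add_le_add (hl m σ hσ v) (hl (m + 1) σ hσ v)).trans ?_)
    rw [← add_mul, pow_succ]
    refine mul_le_mul_of_nonneg_right ?_ (norm_nonneg _)
    nlinarith [pow_nonneg hq0 m]
  obtain ⟨p, hp⟩ := cauchySeq_tendsto_of_complete hcauchy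
  have hR : ∀ x, coeHom x * p = GroupAlg.augmentation x • p := fun x => by
    refine tendsto_nhds_unique (hp.const_mul (coeHom x)) ?_
    -- `x l_m - ε(x) l_m` also lies in the augmentation ideal, and it inherits the decay `q ^ m`
    -- from `l_m`.
    have h0 : Tendsto (fun m => coeHom (x * l m) - coeHom (GroupAlg.augmentation x • l m))
        atTop (𝓝 0) := by
      refine squeeze_zero_norm (a := fun m => (‖x‖ + ‖GroupAlg.augmentation x‖) * q ^ m)
        (fun m => ?_) (by simpa using hqt.const_mul (‖x‖ + ‖GroupAlg.augmentation x‖))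
      rw [← map_sub, norm_coeHom]
      refine GroupAlg.norm_le_of_noInvariants ?_ (by positivity) fun σ hσ v => ?_
      · rw [map_sub, map_mul, map_smul, haug, smul_eq_mul, sub_self]
      · rw [map_sub, map_mul, map_smul, LinearMap.sub_apply, Module.End.mul_apply,
          LinearMap.smul_apply, add_mul, add_mul, mul_assoc, mul_assoc]
        refine (norm_sub_le _ _).trans (add_le_add ?_ ?_)
        · exact (σ.norm_repAct_le _ _).trans
            (mul_le_mul_of_nonneg_left (hl m σ hσ v) (norm_nonneg _))
        · rw [norm_smul]
          exact mul_le_mul_of_nonneg_left (hl m σ hσ v) (norm_nonneg _)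
    have h1 := h0.add (hp.const_smul (GroupAlg.augmentation x))
    rw [zero_add] at h1
    refine h1.congr fun m => ?_
    rw [map_smul, map_mul, sub_add_cancel]
  have hL : ∀ x, p * coeHom x = GroupAlg.augmentation x • p := fun x => by
    refine tendsto_nhds_unique (hp.mul_const (coeHom x)) ?_
    have h0 : Tendsto (fun m => coeHom (l m * x) - coeHom (GroupAlg.augmentation x • l m))
        atTop (𝓝 0) := by
      refine squeeze_zero_norm (a := fun m => (‖x‖ + ‖GroupAlg.augmentation x‖) * q ^ m)
        (fun m => ?_) (by simpa using hqt.const_mul (‖x‖ + ‖GroupAlg.augmentation x‖))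
      rw [← map_sub, norm_coeHom]
      refine GroupAlg.norm_le_of_noInvariants ?_ (by positivity) fun σ hσ v => ?_
      · rw [map_sub, map_mul, map_smul, haug, smul_eq_mul, one_mul, mul_one, sub_self]
      · rw [map_sub, map_mul, map_smul, LinearMap.sub_apply, Module.End.mul_apply,
          LinearMap.smul_apply, add_mul, add_mul, mul_assoc, mul_assoc]
        refine (norm_sub_le _ _).trans (add_le_add ?_ ?_)
        · refine (hl m σ hσ _).trans ?_
          rw [mul_left_comm]
          exact mul_le_mul_of_nonneg_left (σ.norm_repAct_le _ _) (by positivity)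
        · rw [norm_smul]
          exact mul_le_mul_of_nonneg_left (hl m σ hσ v) (norm_nonneg _)
    have h1 := h0.add (hp.const_smul (GroupAlg.augmentation x))
    rw [zero_add] at h1
    refine h1.congr fun m => ?_
    rw [map_smul, map_mul, sub_add_cancel]
  refine ⟨p, ?_, fun a => ?_, fun a => ?_, fun x r hr hx => ?_⟩
  · refine tendsto_nhds_unique ((continuous_augmentation.tendsto p).comp hp) ?_
    refine tendsto_const_nhds.congr fun m => ?_
    rw [Function.comp_apply, augmentation_coeHom, haug]
  · induction a using induction_coeHom with
    | hP =>
      exact isClosed_eq (continuous_mul_const p) (continuous_augmentation.smul continuous_const)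
    | h x => rw [hR, augmentation_coeHom]
  · induction a using induction_coeHom with
    | hP =>
      exact isClosed_eq (continuous_const_mul p) (continuous_augmentation.smul continuous_const)
    | h x => rw [hL, augmentation_coeHom]
  -- `x (1 - l_m)` has augmentation zero whatever `x` is. The factor 2 comes from the bound `1 + q ^
  -- m ≤ 2` for `1 - l_m`.
  · refine le_of_tendsto' ((hp.const_sub 1).const_mul (coeHom x)).norm fun m => ?_
    rw [← map_one coeHom, ← map_sub, ← map_mul, norm_coeHom]
    refine GroupAlg.norm_le_of_noInvariants ?_ (by positivity) fun σ hσ v => ?_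
    · rw [map_mul, map_sub, haug, map_one, sub_self, mul_zero]
    · rw [map_mul, Module.End.mul_apply, mul_comm 2 r, mul_assoc]
      refine (hx σ hσ _).trans (mul_le_mul_of_nonneg_left ?_ hr)
      rw [map_sub, map_one, LinearMap.sub_apply, Module.End.one_apply, two_mul]
      refine (norm_sub_le _ _).trans (add_le_add le_rfl ((hl m σ hσ v).trans ?_))
      exact mul_le_of_le_one_left (norm_nonneg _) (hq m)

namespace IsKazhdanProjection

variable {p : MaxCStar Γ} (hp : IsKazhdanProjection p)
include hp

lemma comm (a : MaxCStar Γ) : p * a = a * p := by rw [hp.mul_left, hp.mul_right]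

variable {a b c : Type} [DecidableEq b] [Fintype a] [Fintype b] [Fintype c]

lemma scal_comm [DecidableEq a] (M : Matrix b a (MaxCStar Γ)) : scal b p * M = M * scal a p := by
  ext i j
  rw [diagonal_mul, mul_diagonal, hp.comm]

lemma scal_sub_comm [DecidableEq a] (M : Matrix b a (MaxCStar Γ)) :
    scal b (1 - p) * M = M * scal a (1 - p) := by
  ext i j
  rw [diagonal_mul, mul_diagonal, sub_mul, mul_sub, hp.comm, one_mul, mul_one]

/-- Multiplication by `p` collapses the algebra to `ℂ` through the augmentation. Problems on the
range of `p` thereby become problems about complex matrices. -/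
lemma mapMat_mul_scal {b : Type} [DecidableEq a] (M : Matrix b a (GroupAlg Γ)) :
    mapMat M * scal a p = ofComplex Γ (M.map GroupAlg.augmentation) * scal a p := by
  ext i j
  rw [mul_diagonal, mul_diagonal]
  change coeHom (M i j) * p = algebraMap ℂ _ (GroupAlg.augmentation (M i j)) * p
  rw [hp.mul_right, augmentation_coeHom, Algebra.smul_def]

/-- The complex given by two matrices with Laplacian bounded below admits a contracting homotopy
on the complement of the Kazhdan projection. -/
theorem exists_homotopy (D : Matrix b a (GroupAlg Γ)) (D' : Matrix c b (GroupAlg Γ))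
    (h0 : D' * D = 0) (hB : UnitaryRep.BoundedBelow (fromRows D' Dᴴ)) :
    ∃ (X : Matrix a b (MaxCStar Γ)) (Y : Matrix b c (MaxCStar Γ)),
      mapMat D * X + Y * mapMat D' = scal b (1 - p) := by
  obtain ⟨κ, q, -, hq0, hq1, hT⟩ := hB.exists_contraction
  rw [conjTranspose_fromRows_eq_fromCols_conjTranspose, fromCols_mul_fromRows,
    conjTranspose_conjTranspose] at hT
  set T := 1 - (κ : ℂ) • (D'ᴴ * D' + D * Dᴴ) with hTdef
  let m : Matrix b b (GroupAlg Γ) →ₐ[ℂ] Matrix b b (MaxCStar Γ) := coeHom.mapMatrix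
  set E : Matrix b b (MaxCStar Γ) := scal b (1 - p)
  have hE : ∀ M, Commute E M := fun M => hp.scal_sub_comm M
  have hentry : ∀ k i j, ‖(m T ^ k * E) i j‖ ≤ 2 * q ^ k := fun k i j => by
    rw [← map_pow, mul_diagonal]
    exact hp.norm_le _ _ (by positivity) fun σ hσ v =>
      UnitaryRep.norm_repAct_pow_le hq0 (hT σ hσ) k i j v
  have hgeom : Summable fun k => 2 * q ^ k := (summable_geometric_of_lt_one hq0 hq1).mul_left 2
  -- Neumann series for the inverse of `1 - T`, that is of `κ` times the Laplacian. The factor `E`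
  -- is needed for convergence, since the contraction estimate is available only away from the
  -- invariant vectors.
  let S : Matrix b b (MaxCStar Γ) := fun i j => ∑' k, (m T ^ k * E) i j
  have hS : Tendsto (fun N => ∑ k ∈ Finset.range N, m T ^ k * E) atTop (𝓝 S) := by
    refine tendsto_pi_nhds.2 fun i => tendsto_pi_nhds.2 fun j => ?_
    have := (Summable.of_norm_bounded hgeom fun k => hentry k i j).hasSum.tendsto_sum_nat
    refine this.congr fun N => ?_
    rw [Matrix.sum_apply]
  have hzero : Tendsto (fun N => m T ^ N * E) atTop (𝓝 0) := by
    refine tendsto_pi_nhds.2 fun i => tendsto_pi_nhds.2 fun j => ?_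
    refine squeeze_zero_norm (fun N => hentry N i j) ?_
    simpa using (tendsto_pow_atTop_nhds_zero_of_lt_one hq0 hq1).const_mul 2
  have h1 : (1 - m T) * S = E := by
    refine tendsto_nhds_unique (hS.const_mul (1 - m T)) ?_
    have h2 := hzero.const_sub E
    rw [sub_zero] at h2
    refine h2.congr fun N => ?_
    rw [← Finset.sum_mul, ← mul_assoc, mul_neg_geom_sum, sub_mul, one_mul]
  -- Because `D' D = 0`, the two summands of the Laplacian annihilate each other, so each commutes
  -- with `T`.
  have hcomm : Commute T (D'ᴴ * D') := by
    have h3 : D'ᴴ * D' * (D * Dᴴ) = 0 := by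
      rw [Matrix.mul_assoc, ← Matrix.mul_assoc D', h0, Matrix.zero_mul, Matrix.mul_zero]
    have h4 : D * Dᴴ * (D'ᴴ * D') = 0 := by
      rw [Matrix.mul_assoc, ← Matrix.mul_assoc Dᴴ, ← conjTranspose_mul, h0, conjTranspose_zero,
        Matrix.zero_mul, Matrix.mul_zero]
    refine (Commute.one_left _).sub_left (Commute.smul_left (Commute.add_left rfl ?_) _)
    rw [Commute, SemiconjBy, h3, h4]
  have h5 : S * m (D'ᴴ * D') = m (D'ᴴ * D') * S := by
    refine tendsto_nhds_unique (hS.mul_const _) ((hS.const_mul _).congr fun N => ?_)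
    have h6 : Commute (m (D'ᴴ * D')) (∑ k ∈ Finset.range N, m T ^ k * E) :=
      Commute.sum_right _ _ _ fun k _ =>
        ((hcomm.symm.map m).pow_right k).mul_right (hE _).symm
    exact h6
  have h7 : 1 - m T = (κ : ℂ) • (m (D'ᴴ * D') + m (D * Dᴴ)) := by
    rw [hTdef, map_sub, map_one, map_smul, map_add, sub_sub_cancel]
  rw [h7, smul_mul_assoc, add_mul, ← h5] at h1
  -- As in Hodge theory, the homotopy is the adjoint differential composed with the inverse
  -- Laplacian. Commuting `S` past `D'ᴴ D'` turns `D X + Y D'` into the Laplacian times `κ S`.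
  refine ⟨(κ : ℂ) • (mapMat Dᴴ * S), (κ : ℂ) • (S * mapMat D'ᴴ), ?_⟩
  rw [← h1, Matrix.mul_smul, Matrix.smul_mul, ← smul_add, add_comm, ← Matrix.mul_assoc,
    Matrix.mul_assoc S, ← mapMat_mul, ← mapMat_mul]
  rfl

end IsKazhdanProjection

end MaxCStar

/-! ### Linear algebra over `ℂ`, and the contribution of the trivial representation. -/

section QuasiInverse

open Matrix

variable {a b c : Type} [DecidableEq a] [DecidableEq b] [DecidableEq c]
  [Fintype a] [Fintype b] [Fintype c]

lemma LinearMap.exists_quasiInverse {K V W : Type} [Field K] [AddCommGroup V] [Module K V]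
    [AddCommGroup W] [Module K W] (f : V →ₗ[K] W) : ∃ g : W →ₗ[K] V, ∀ v, f (g (f v)) = f v := by
  obtain ⟨s, hs⟩ := f.rangeRestrict.exists_rightInverse_of_surjective f.range_rangeRestrict
  obtain ⟨r, hr⟩ := (LinearMap.range f).subtype.exists_leftInverse_of_injective
    (Submodule.ker_subtype _)
  refine ⟨s ∘ₗ r, fun v => ?_⟩
  have h1 : r (f v) = f.rangeRestrict v := LinearMap.congr_fun hr (f.rangeRestrict v)
  rw [LinearMap.comp_apply, h1]
  exact congrArg Subtype.val (LinearMap.congr_fun hs (f.rangeRestrict v))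

lemma Matrix.exists_quasiInverse (M : Matrix c b ℂ) : ∃ G : Matrix b c ℂ, M * G * M = M := by
  obtain ⟨g, hg⟩ := M.toLin'.exists_quasiInverse
  refine ⟨LinearMap.toMatrix' g, Matrix.toLin'.injective (LinearMap.ext fun v => ?_)⟩
  rw [Matrix.toLin'_mul, Matrix.toLin'_mul, Matrix.toLin'_toMatrix']
  exact hg v

/-- For a quasi-inverse `G'` of `M'`, the matrix `1 - G' M'` maps into `ker M' = im M`. There `M G`
is the identity when `G` is a quasi-inverse of `M`. -/
lemma Matrix.exists_homotopy_of_exact (M : Matrix b a ℂ) (M' : Matrix c b ℂ)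
    (h : ∀ v, M' *ᵥ v = 0 → ∃ u, M *ᵥ u = v) :
    ∃ (X : Matrix a b ℂ) (Y : Matrix b c ℂ), M * X + Y * M' = 1 := by
  obtain ⟨G, hG⟩ := M.exists_quasiInverse
  obtain ⟨G', hG'⟩ := M'.exists_quasiInverse
  refine ⟨G * (1 - G' * M'), G', ?_⟩
  have h1 : M * (G * (1 - G' * M')) = 1 - G' * M' := by
    refine Matrix.toLin'.injective (LinearMap.ext fun v => ?_)
    obtain ⟨u, hu⟩ := h ((1 - G' * M') *ᵥ v) (by
      rw [mulVec_mulVec, Matrix.mul_sub, Matrix.mul_one, ← Matrix.mul_assoc, hG', sub_self,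
        zero_mulVec])
    rw [Matrix.toLin'_apply, Matrix.toLin'_apply, ← mulVec_mulVec, ← mulVec_mulVec, ← hu,
      mulVec_mulVec, mulVec_mulVec, hG]
  rw [h1, sub_add_cancel]

end QuasiInverse

namespace MaxCStar.IsKazhdanProjection

open Matrix

variable {Γ : Type} [Group Γ] {p : MaxCStar Γ} (hp : IsKazhdanProjection p)
  {a b c : Type} [DecidableEq b] [DecidableEq c] [Fintype a] [Fintype b] [Fintype c]
include hp

/-- A quasi-inverse on the complement of the Kazhdan projection extends to a quasi-inverse. -/
theorem exists_quasiInverse (D : Matrix b a (GroupAlg Γ)) (D' : Matrix c b (GroupAlg Γ))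
    (h0 : D' * D = 0) {X : Matrix a b (MaxCStar Γ)} {Y : Matrix b c (MaxCStar Γ)}
    (hXY : mapMat D * X + Y * mapMat D' = scal b (1 - p)) :
    ∃ G : Matrix b c (MaxCStar Γ), mapMat D' * G * mapMat D' = mapMat D' := by
  obtain ⟨G, hG⟩ := (D'.map GroupAlg.augmentation).exists_quasiInverse
  have hDD : mapMat D' * mapMat D = 0 := by
    rw [← mapMat_mul, h0, mapMat, Matrix.map_zero _ (map_zero _)]
  -- Multiplying the homotopy identity by `D'` on the left removes the term with `D X`, so `Y` is a
  -- quasi-inverse on the complement of `p`. The complex matrix `G` supplies the part on the range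
  -- of `p`.
  have h1 : mapMat D' * Y * mapMat D' = mapMat D' * scal b (1 - p) := by
    rw [← hXY, Matrix.mul_add, ← Matrix.mul_assoc, hDD, Matrix.zero_mul, zero_add,
      Matrix.mul_assoc]
  have h2 : mapMat D' * (ofComplex Γ G * scal c p) * mapMat D' = mapMat D' * scal b p := by
    rw [← hp.scal_comm, ← Matrix.mul_assoc, hp.mapMat_mul_scal, Matrix.mul_assoc,
      Matrix.mul_assoc, hp.scal_comm, Matrix.mul_assoc (ofComplex Γ G), hp.mapMat_mul_scal,
      ← Matrix.mul_assoc, ← Matrix.mul_assoc, ← ofComplex_mul, ← ofComplex_mul, hG]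
  refine ⟨Y + ofComplex Γ G * scal c p, ?_⟩
  rw [Matrix.mul_add, Matrix.add_mul, h1, h2, ← Matrix.mul_add, diagonal_add]
  simp

/-- A homotopy on the complement of the Kazhdan projection extends to a homotopy if the complex is
exact in the trivial representation. -/
theorem exists_homotopy_of_exact [DecidableEq a] (D : Matrix b a (GroupAlg Γ))
    (D' : Matrix c b (GroupAlg Γ))
    (hex : ∀ v, D'.map GroupAlg.augmentation *ᵥ v = 0 →
      ∃ u, D.map GroupAlg.augmentation *ᵥ u = v)
    {X : Matrix a b (MaxCStar Γ)} {Y : Matrix b c (MaxCStar Γ)}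
    (hXY : mapMat D * X + Y * mapMat D' = scal b (1 - p)) :
    ∃ (X : Matrix a b (MaxCStar Γ)) (Y : Matrix b c (MaxCStar Γ)),
      mapMat D * X + Y * mapMat D' = 1 := by
  obtain ⟨X₀, Y₀, h₀⟩ := Matrix.exists_homotopy_of_exact _ _ hex
  refine ⟨X + scal a p * ofComplex Γ X₀, Y + ofComplex Γ Y₀ * scal c p, ?_⟩
  have h1 : mapMat D * (scal a p * ofComplex Γ X₀) + ofComplex Γ Y₀ * scal c p * mapMat D' =
      scal b p := by
    rw [← Matrix.mul_assoc, hp.mapMat_mul_scal, Matrix.mul_assoc, hp.scal_comm,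
      Matrix.mul_assoc, hp.scal_comm, hp.mapMat_mul_scal, ← Matrix.mul_assoc,
      ← Matrix.mul_assoc, ← Matrix.add_mul, ← ofComplex_mul, ← ofComplex_mul,
      ← Matrix.map_add _ (map_add _), h₀, Matrix.map_one _ (map_zero _) (map_one _),
      Matrix.one_mul]
  rw [Matrix.mul_add, Matrix.add_mul, add_add_add_comm, hXY, h1, diagonal_add]
  simp

end MaxCStar.IsKazhdanProjection

/-! ### Cochains on complexes of retracts, and a Hausdorff criterion. -/

namespace ChainComplex

open Limits

universe v u

variable {C : Type u} [Category.{v} C] [Preadditive C]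

/-- Since `0 - 1 = 0` in `ℕ`, the map leaving degree 0 is `P.d 0 0`. Its vanishing lets later
statements use `k - 1` without treating degree 0 separately. -/
lemma d_zero_pred (P : ChainComplex C ℕ) : P.d 0 (0 - 1) = 0 := P.shape _ _ (by simp)

lemma d_comp_d_pred (P : ChainComplex C ℕ) (k : ℕ) : P.d (k + 1) k ≫ P.d k (k - 1) = 0 := by
  cases k with
  | zero => rw [d_zero_pred, comp_zero]
  | succ k => exact P.d_comp_d _ _ _

/-- The cohomology of `Hom(P, A)` vanishes in degree `k`. -/
def HomExact (P : ChainComplex C ℕ) (A : C) (k : ℕ) : Prop :=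
  ∀ z : P.X k ⟶ A, P.d (k + 1) k ≫ z = 0 → ∃ y : P.X (k - 1) ⟶ A, P.d k (k - 1) ≫ y = z

lemma exists_homotopy_at {P : ChainComplex C ℕ} {f : P ⟶ P} (h : Homotopy f (𝟙 P)) (k : ℕ) :
    ∃ (s : P.X (k - 1) ⟶ P.X k) (t : P.X k ⟶ P.X (k + 1)),
      f.f k = P.d k (k - 1) ≫ s + t ≫ P.d (k + 1) k + 𝟙 (P.X k) := by
  refine ⟨h.hom (k - 1) k, h.hom k (k + 1), ?_⟩
  have h1 := h.comm k
  rw [Homotopy.prevD_chainComplex] at h1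
  cases k with
  | zero => rw [Homotopy.dNext_zero_chainComplex] at h1; rw [h1, d_zero_pred, zero_comp]; rfl
  | succ k => rw [Homotopy.dNext_succ_chainComplex] at h1; exact h1

/-- On a cocycle, the homotopy from `f ≫ g` to the identity contributes just a coboundary. A
primitive of the pullback along `g` can therefore be carried back along `f` and corrected. -/
lemma exists_of_comp {P Q : ChainComplex C ℕ} (f : P ⟶ Q) (g : Q ⟶ P)
    (h : Homotopy (f ≫ g) (𝟙 P)) {A : C} {k : ℕ} (z : P.X k ⟶ A) (hz : P.d (k + 1) k ≫ z = 0)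
    (hy : ∃ y, Q.d k (k - 1) ≫ y = g.f k ≫ z) : ∃ y, P.d k (k - 1) ≫ y = z := by
  obtain ⟨y, hy⟩ := hy
  obtain ⟨s, t, hst⟩ := exists_homotopy_at h k
  refine ⟨f.f (k - 1) ≫ y - s ≫ z, ?_⟩
  have h1 : f.f k ≫ g.f k ≫ z = P.d k (k - 1) ≫ s ≫ z + z := by
    rw [← Category.assoc, ← HomologicalComplex.comp_f, hst]
    simp [hz]
  rw [Preadditive.comp_sub, ← f.comm_assoc, hy, h1, add_sub_cancel_left]

lemma HomExact.of_homotopyEquiv {P Q : ChainComplex C ℕ} (e : HomotopyEquiv P Q) {A : C} {k : ℕ}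
    (h : Q.HomExact A k) : P.HomExact A k := fun z hz => by
  refine exists_of_comp e.hom e.inv e.homotopyHomInvId z hz (h _ ?_)
  rw [← e.inv.comm_assoc, hz, comp_zero]

/-- A family of retractions from objects `F k` to the terms of a chain complex. -/
structure Retracts (P : ChainComplex C ℕ) (F : ℕ → C) where
  /-- the retraction -/
  r (k : ℕ) : F k ⟶ P.X k
  /-- the section -/
  i (k : ℕ) : P.X k ⟶ F k
  i_r (k : ℕ) : i k ≫ r k = 𝟙 (P.X k)

namespace Retracts

variable {P : ChainComplex C ℕ} {F : ℕ → C} (R : P.Retracts F)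

/-- The differential transported to the objects `F k`. -/
def δ (k l : ℕ) : F k ⟶ F l := R.r k ≫ P.d k l ≫ R.i l

/-- The idempotent of `F k` that defines the retract. -/
def idem (k : ℕ) : F k ⟶ F k := R.r k ≫ R.i k

lemma i_r_assoc' (k : ℕ) {A : C} (z : P.X k ⟶ A) : R.i k ≫ R.r k ≫ z = z := by
  rw [← Category.assoc, R.i_r, Category.id_comp]

lemma δ_comp_δ (k : ℕ) : R.δ (k + 1) k ≫ R.δ k (k - 1) = 0 := by
  simp only [δ, Category.assoc, i_r_assoc']
  rw [← Category.assoc (P.d _ _), d_comp_d_pred, zero_comp, comp_zero]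

lemma idem_comp_δ (k l : ℕ) : R.idem k ≫ R.δ k l = R.δ k l := by
  simp only [δ, idem, Category.assoc, i_r_assoc']

lemma δ_comp_idem (k l : ℕ) : R.δ k l ≫ R.idem l = R.δ k l := by
  simp only [δ, idem, Category.assoc, i_r_assoc']

lemma idem_comp_idem (k : ℕ) : R.idem k ≫ R.idem k = R.idem k := by
  simp only [idem, Category.assoc, i_r_assoc']

/-- Maps out of `P.X k` are the maps out of `F k` fixed by the idempotent. The fixed-point condition
is imposed on cocycles, while coboundaries satisfy it automatically. -/
lemma homExact_iff {A : C} {k : ℕ} : P.HomExact A k ↔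
    ∀ v : F k ⟶ A, R.δ (k + 1) k ≫ v = 0 → R.idem k ≫ v = v →
      ∃ u : F (k - 1) ⟶ A, R.δ k (k - 1) ≫ u = v := by
  constructor
  · intro h v hv hv'
    obtain ⟨y, hy⟩ := h (R.i k ≫ v) (by
      rw [← R.i_r_assoc' (k + 1) (P.d (k + 1) k ≫ R.i k ≫ v)]
      simp only [δ, Category.assoc] at hv
      rw [hv, comp_zero])
    refine ⟨R.r (k - 1) ≫ y, ?_⟩
    simp only [δ, Category.assoc, i_r_assoc', hy]
    simpa only [idem, Category.assoc] using hv'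
  · intro h z hz
    obtain ⟨u, hu⟩ := h (R.r k ≫ z)
      (by simp only [δ, Category.assoc, i_r_assoc', hz, comp_zero])
      (by simp only [idem, Category.assoc, i_r_assoc'])
    refine ⟨R.i (k - 1) ≫ u, ?_⟩
    rw [← R.i_r_assoc' k z, ← hu]
    simp only [δ, Category.assoc, i_r_assoc']

/-- Detecting coboundaries on a homotopy equivalent complex. -/
lemma exists_iff {B : ChainComplex C ℕ} (e : HomotopyEquiv P B) {A : C} {k : ℕ}
    (z : B.X (k + 1) ⟶ A) (hz : B.d (k + 2) (k + 1) ≫ z = 0) :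
    (∃ y, B.d (k + 1) k ≫ y = z) ↔
      ∃ u : F k ⟶ A, R.δ (k + 1) k ≫ u = R.r (k + 1) ≫ e.hom.f (k + 1) ≫ z := by
  constructor
  · rintro ⟨y, rfl⟩
    refine ⟨R.r k ≫ e.hom.f k ≫ y, ?_⟩
    simp only [δ, Category.assoc, i_r_assoc', HomologicalComplex.Hom.comm_assoc]
  · rintro ⟨u, hu⟩
    refine exists_of_comp (k := k + 1) e.inv e.hom e.homotopyInvHomId z hz
      ⟨R.i k ≫ u, ?_⟩
    rw [← R.i_r_assoc' (k + 1) (e.hom.f (k + 1) ≫ z), ← hu]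
    simp only [δ, Category.assoc, i_r_assoc']
    rfl

end Retracts

end ChainComplex

/-- A criterion for the quotient topology to be Hausdorff. -/
theorem t2Space_coinduced {Z H C : Type} [AddCommGroup Z] [AddCommGroup H] [AddCommGroup C]
    [TopologicalSpace C] [IsTopologicalAddGroup C] (i : Z →+ C) (π : Z →+ H)
    (hπ : Function.Surjective π) {S : Set C} (hS : IsClosed S) (h : ∀ z, π z = 0 ↔ i z ∈ S) :
    @T2Space H (TopologicalSpace.coinduced π (TopologicalSpace.induced i inferInstance)) := by
  let : TopologicalSpace Z := TopologicalSpace.induced i inferInstance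
  have : IsTopologicalAddGroup Z := topologicalAddGroup_induced i
  let : TopologicalSpace H := TopologicalSpace.coinduced π inferInstance
  have hker : IsClosed (π.ker : Set Z) := by
    have : (π.ker : Set Z) = i ⁻¹' S := by ext z; exact h z
    rw [this]
    exact hS.preimage continuous_induced_dom
  have : IsClosed (π.ker : Set Z) := hker
  -- The quotient of `Z` by a closed subgroup is Hausdorff, and the inverse of `e` maps `H` into it
  -- continuously and injectively.
  let e := QuotientAddGroup.quotientKerEquivOfSurjective π hπ
  refine T2Space.of_injective_continuous (f := e.symm) e.symm.injective ?_
  refine continuous_coinduced_dom.2 ?_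
  have h2 : e.symm ∘ π = ((↑) : Z → Z ⧸ π.ker) := by
    ext z
    exact e.symm_apply_eq.2 rfl
  rw [h2]
  exact continuous_quot_mk

/-! ### Group cohomology through inhomogeneous cochains. -/

section Cochains

open groupCohomology

variable {Γ V : Type} [Group Γ] [AddCommGroup V] [Module ℂ V] (ρ : Representation ℂ Γ V)

/-- The differential of inhomogeneous cochains. -/
def cochainD (k l : ℕ) : ((Fin k → Γ) → V) →ₗ[ℂ] ((Fin l → Γ) → V) :=
  ((inhomogeneousCochains (Rep.of ρ)).d k l).hom

lemma cochainD_succ_apply (k : ℕ) (z : (Fin k → Γ) → V) (g : Fin (k + 1) → Γ) :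
    cochainD ρ k (k + 1) z g = ρ (g 0) (z fun i => g i.succ) +
      ∑ j : Fin (k + 1), (-1 : ℂ) ^ ((j : ℕ) + 1) • z (Fin.contractNth j (· * ·) g) := by
  have h : (inhomogeneousCochains (Rep.of ρ)).d k (k + 1) = _ := inhomogeneousCochains.d_def _ k
  rw [cochainD, h]
  rfl

lemma cochainD_zero_pred (z : (Fin (0 - 1) → Γ) → V) : cochainD ρ (0 - 1) 0 z = 0 := by
  have h : (inhomogeneousCochains (Rep.of ρ)).d (0 - 1) 0 = 0 :=
    HomologicalComplex.shape _ _ _ (by simp)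
  rw [cochainD, h]
  rfl

lemma π_eq_zero_iff (k : ℕ) (z : cocycles (Rep.of ρ) k) :
    π (Rep.of ρ) k z = 0 ↔ ∃ y, cochainD ρ (k - 1) k y = iCocycles (Rep.of ρ) k z := by
  have hk : (ComplexShape.up ℕ).prev k = k - 1 := by cases k <;> simp
  have hex := ShortComplex.exact_of_g_is_cokernel
    (ShortComplex.mk ((inhomogeneousCochains (Rep.of ρ)).toCycles (k - 1) k)
      ((inhomogeneousCochains (Rep.of ρ)).homologyπ k) (by simp))
    ((inhomogeneousCochains (Rep.of ρ)).homologyIsCokernel (k - 1) k hk)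
  rw [ShortComplex.moduleCat_exact_iff] at hex
  constructor
  · intro h
    obtain ⟨y, hy⟩ := hex z h
    refine ⟨y, ?_⟩
    rw [← hy]
    exact (LinearMap.congr_fun (congrArg ModuleCat.Hom.hom
      ((inhomogeneousCochains (Rep.of ρ)).toCycles_i (k - 1) k)) y).symm
  · rintro ⟨y, hy⟩
    have hz : (inhomogeneousCochains (Rep.of ρ)).toCycles (k - 1) k y = z := by
      refine (ModuleCat.mono_iff_injective (iCocycles (Rep.of ρ) k)).1 inferInstance ?_
      rw [← hy]
      exact LinearMap.congr_fun (congrArg ModuleCat.Hom.hom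
        ((inhomogeneousCochains (Rep.of ρ)).toCycles_i (k - 1) k)) y
    rw [← hz]
    exact LinearMap.congr_fun (congrArg ModuleCat.Hom.hom
      ((inhomogeneousCochains (Rep.of ρ)).toCycles_comp_homologyπ (k - 1) k)) y

lemma cochainD_iCocycles (k : ℕ) (z : cocycles (Rep.of ρ) k) :
    cochainD ρ k (k + 1) (iCocycles (Rep.of ρ) k z) = 0 :=
  LinearMap.congr_fun (congrArg ModuleCat.Hom.hom
    ((inhomogeneousCochains (Rep.of ρ)).iCycles_d k (k + 1))) z

lemma exists_cocycle {k : ℕ} {z : (Fin k → Γ) → V} (hz : cochainD ρ k (k + 1) z = 0) :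
    ∃ w, iCocycles (Rep.of ρ) k w = z :=
  ⟨(inhomogeneousCochains (Rep.of ρ)).cyclesMk z (k + 1) (by simp) hz,
    (inhomogeneousCochains (Rep.of ρ)).i_cyclesMk z (k + 1) (by simp) hz⟩

lemma cohomologyVanishes_iff (k : ℕ) : CohomologyVanishes ρ k ↔
    ∀ z, cochainD ρ k (k + 1) z = 0 → ∃ y, cochainD ρ (k - 1) k y = z := by
  constructor
  · intro h z hz
    obtain ⟨w, rfl⟩ := exists_cocycle ρ hz
    exact (π_eq_zero_iff ρ k w).1 (h.elim _ _)
  · intro h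
    refine subsingleton_of_forall_eq 0 fun x => ?_
    induction x using groupCohomology_induction_on with
    | h w => exact (π_eq_zero_iff ρ k w).2 (h _ (cochainD_iCocycles ρ k w))

lemma hausdorffCohomology_of_isClosed [TopologicalSpace V] [IsTopologicalAddGroup V] {k : ℕ}
    {S : Set ((Fin k → Γ) → V)} (hS : IsClosed S)
    (h : ∀ z, cochainD ρ k (k + 1) z = 0 → ((∃ y, cochainD ρ (k - 1) k y = z) ↔ z ∈ S)) :
    HausdorffCohomology ρ k :=
  t2Space_coinduced (C := (Fin k → Γ) → V) (iCocycles (Rep.of ρ) k).hom.toAddMonoidHom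
    (π (Rep.of ρ) k).hom.toAddMonoidHom
    (fun x => by induction x using groupCohomology_induction_on with | h w => exact ⟨w, rfl⟩)
    hS fun z => (π_eq_zero_iff ρ k z).trans (h _ (cochainD_iCocycles ρ k z))

end Cochains

/-! ### Maps from free `ℚΓ`-modules to complex representations, as tuples and matrices. -/

section RatRep

variable {Γ V : Type} [Group Γ] [AddCommGroup V] [Module ℂ V]

/-- A complex representation as a rational representation. -/
def ratRep (ρ : Representation ℂ Γ V) : Rep.{0} ℚ Γ :=
  letI : Module ℚ V := Module.compHom V (algebraMap ℚ ℂ)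
  Rep.of (k := ℚ)
    { toFun := fun g =>
        { toFun := ρ g, map_add' := map_add _, map_smul' := fun q v => map_smul (ρ g) (q : ℂ) v }
      map_one' := by ext v; exact LinearMap.congr_fun (map_one ρ) v
      map_mul' := fun g h => by ext v; exact LinearMap.congr_fun (map_mul ρ g h) v }

namespace ratRep

variable {ι α β : Type} {ρ : Representation ℂ Γ V}

/-- The underlying additive map of a morphism to `ratRep ρ`. -/
def app {X : Rep.{0} ℚ Γ} (f : X ⟶ ratRep ρ) : X →+ V := f.hom.toLinearMap.toAddMonoidHom

lemma app_comp {X Y : Rep.{0} ℚ Γ} (θ : X ⟶ Y) (f : Y ⟶ ratRep ρ) (x : X) :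
    app (θ ≫ f) x = app f (θ.hom x) := rfl

variable (ρ) in
/-- The morphism from a free representation given by a tuple of vectors. -/
def lift (v : ι → V) : Rep.free ℚ Γ ι ⟶ ratRep ρ := Rep.freeLift (A := ratRep ρ) ℚ Γ v

/-- The tuple of vectors given by a morphism from a free representation. -/
def eval (f : Rep.free ℚ Γ ι ⟶ ratRep ρ) : ι → V :=
  fun i => app f (Finsupp.single i (MonoidAlgebra.single 1 1))

lemma app_lift_single (v : ι → V) (i : ι) (g : Γ) (q : ℚ) :
    app (lift ρ v) (Finsupp.single i (MonoidAlgebra.single g q)) = (q : ℂ) • ρ g (v i) :=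
  Representation.freeLift_single_single (ratRep ρ).ρ i g q v

lemma eval_lift (v : ι → V) : eval (lift ρ v) = v := by
  ext i
  rw [eval, app_lift_single, map_one]
  simp

lemma eval_injective : Function.Injective (eval : (Rep.free ℚ Γ ι ⟶ ratRep ρ) → ι → V) :=
  fun f g h => Rep.free_ext ℚ Γ (ratRep ρ) f g fun i => congrFun h i

lemma lift_eval (f : Rep.free ℚ Γ ι ⟶ ratRep ρ) : lift ρ (eval f) = f :=
  eval_injective (eval_lift _)

lemma lift_injective : Function.Injective (lift ρ : (ι → V) → (Rep.free ℚ Γ ι ⟶ ratRep ρ)) :=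
  fun v w h => by rw [← eval_lift (ρ := ρ) v, h, eval_lift]

lemma lift_zero : lift ρ (0 : ι → V) = 0 := eval_injective (by rw [eval_lift]; rfl)

variable (Γ) in
/-- The left regular representation on the group algebra. -/
def regular : Representation ℂ Γ (GroupAlg Γ) :=
  (Algebra.lmul ℂ (GroupAlg Γ) : GroupAlg Γ →* Module.End ℂ (GroupAlg Γ)).comp GroupAlg.of

lemma repAct_regular (x y : GroupAlg Γ) : repAct (regular Γ) x y = x * y := by
  rw [repAct_eq_of (φ := Algebra.lmul ℂ (GroupAlg Γ)) fun _ => rfl]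
  rfl

/-- The action of a morphism from a free representation through the group algebra. -/
lemma app_lift_eq_sum [Fintype β] [DecidableEq β] (v : β → V) (x : Rep.free ℚ Γ β) :
    app (lift ρ v) x =
      ∑ i, repAct ρ (app (lift (regular Γ) (Pi.single i 1)) x) (v i) := by
  induction x using Finsupp.induction_linear with
  | zero => simp
  | add x y hx hy => simp only [map_add, LinearMap.add_apply, Finset.sum_add_distrib, hx, hy]
  | single j x =>
    induction x using MonoidAlgebra.induction_linear with
    | zero => simp
    | add x y hx hy =>
      simp only [Finsupp.single_add, map_add, LinearMap.add_apply, Finset.sum_add_distrib, hx, hy]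
    | single g q =>
      refine (app_lift_single v j g q).trans ?_
      have h (i : β) : app (lift (regular Γ) (Pi.single i 1)) (Finsupp.single j (.single g q)) =
        (q : ℂ) • (GroupAlg.of g * (Pi.single i 1 : β → GroupAlg Γ) j) := app_lift_single _ j g q
      rw [Finset.sum_eq_single j]
      · refine Eq.trans ?_ (congrArg (fun a => repAct ρ a (v j)) (h j)).symm
        rw [Pi.single_eq_same, mul_one, map_smul, repAct_of, LinearMap.smul_apply]
      · intro i _ hi
        refine (congrArg (fun a => repAct ρ a (v i)) (h i)).trans ?_
        rw [Pi.single_eq_of_ne' hi, mul_zero, smul_zero, map_zero, LinearMap.zero_apply]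
      · simp

/-- The matrix over the group algebra of a morphism of free representations. -/
def toMat [DecidableEq β] (θ : Rep.free ℚ Γ α ⟶ Rep.free ℚ Γ β) : Matrix α β (GroupAlg Γ) :=
  fun j i => eval (θ ≫ lift (regular Γ) (Pi.single i 1)) j

lemma eval_comp_lift [Fintype β] [DecidableEq β] (θ : Rep.free ℚ Γ α ⟶ Rep.free ℚ Γ β)
    (v : β → V) : eval (θ ≫ lift ρ v) = matAct (repAct ρ) (toMat θ) v := by
  ext j
  rw [eval, app_comp, app_lift_eq_sum]
  rfl

lemma toMat_comp [Fintype β] [DecidableEq β] {γ : Type} [DecidableEq γ]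
    (θ : Rep.free ℚ Γ α ⟶ Rep.free ℚ Γ β) (θ' : Rep.free ℚ Γ β ⟶ Rep.free ℚ Γ γ) :
    toMat (θ ≫ θ') = toMat θ * toMat θ' := by
  ext j i
  rw [toMat, Category.assoc, ← lift_eval (θ' ≫ _), eval_comp_lift, matAct_apply,
    Matrix.mul_apply]
  simp only [repAct_regular]
  rfl

lemma toMat_zero [DecidableEq β] : toMat (0 : Rep.free ℚ Γ α ⟶ Rep.free ℚ Γ β) = 0 := by
  ext j i
  rw [toMat, Limits.zero_comp]
  rfl

/-- Equivariant maps from the rational bar resolution to `V` are exactly the inhomogeneous cochains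
of the complex representation. This is where finiteness over `ℚ` meets complex coefficients. -/
lemma eval_barComplex_d (k : ℕ) (z : (Fin k → Γ) → V) :
    eval (ι := Fin (k + 1) → Γ) ((Rep.barComplex ℚ Γ).d (k + 1) k ≫ lift ρ z) =
      cochainD ρ k (k + 1) z := by
  ext g
  rw [Rep.barComplex.d_def, eval, app_comp, Rep.barComplex.d_single, cochainD_succ_apply, map_add,
    map_sum, app_lift_single, Rat.cast_one, one_smul]
  congr 1
  refine Finset.sum_congr rfl fun j _ => ?_
  rw [app_lift_single, map_one, Module.End.one_apply]
  push_cast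
  rfl

lemma barComplex_d_pred (k : ℕ) (y : (Fin (k - 1) → Γ) → V) :
    (Rep.barComplex ℚ Γ).d k (k - 1) ≫ lift ρ y = lift ρ (cochainD ρ (k - 1) k y) := by
  cases k with
  | zero =>
    rw [ChainComplex.d_zero_pred, cochainD_zero_pred, lift_zero, Limits.zero_comp]
  | succ k => exact eval_injective ((eval_barComplex_d k y).trans (eval_lift _).symm)

lemma barComplex_d_comp_lift_eq_zero_iff {k : ℕ} {z : (Fin k → Γ) → V} :
    (Rep.barComplex ℚ Γ).d (k + 1) k ≫ lift ρ z = 0 ↔ cochainD ρ k (k + 1) z = 0 := by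
  rw [← eval_barComplex_d]
  exact ⟨fun h => by rw [h]; rfl, fun h => eval_injective h⟩

lemma exists_barComplex_d_iff {k : ℕ} {z : (Fin k → Γ) → V} :
    (∃ y, (Rep.barComplex ℚ Γ).d k (k - 1) ≫ y = lift ρ z) ↔
      ∃ y, cochainD ρ (k - 1) k y = z := by
  constructor
  · rintro ⟨y, hy⟩
    refine ⟨eval (ι := Fin (k - 1) → Γ) y, lift_injective (ρ := ρ) ?_⟩
    rw [← barComplex_d_pred, lift_eval]
    exact hy
  · rintro ⟨y, rfl⟩
    exact ⟨lift ρ y, barComplex_d_pred k y⟩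

/-- Vanishing of cohomology in terms of the rational bar resolution. -/
theorem cohomologyVanishes_iff_homExact {k : ℕ} :
    CohomologyVanishes ρ k ↔ (Rep.barComplex ℚ Γ).HomExact (ratRep ρ) k := by
  rw [cohomologyVanishes_iff]
  constructor
  · intro h z hz
    have hz' : lift ρ (eval (ι := Fin k → Γ) z) = z := lift_eval (ι := Fin k → Γ) z
    rw [← hz'] at hz ⊢
    exact exists_barComplex_d_iff.2 (h _ (barComplex_d_comp_lift_eq_zero_iff.1 hz))
  · intro h z hz
    exact exists_barComplex_d_iff.1 (h _ (barComplex_d_comp_lift_eq_zero_iff.2 hz))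

end ratRep

end RatRep

/-! ### Presentation of cohomology by finite matrices over the group algebra. -/

namespace ratRep

section Retracts

variable {Γ V : Type} [Group Γ] {P : ChainComplex (Rep.{0} ℚ Γ) ℕ} {ι : ℕ → Type}
  (R : P.Retracts fun j => Rep.free ℚ Γ (ι j)) (k : ℕ)

/-- The matrix of the differential of a complex of projective modules. -/
def diffMat (k l : ℕ) [DecidableEq (ι l)] : Matrix (ι k) (ι l) (GroupAlg Γ) := toMat (R.δ k l)

/-- The matrix of the idempotent whose image is a projective module. -/
def idemMat [DecidableEq (ι k)] : Matrix (ι k) (ι k) (GroupAlg Γ) := toMat (R.idem k)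

/-- The matrix whose kernel is the space of cocycles in degree `k`. -/
def cocycleMat [DecidableEq (ι k)] : Matrix (ι (k + 1) ⊕ ι k) (ι k) (GroupAlg Γ) :=
  Matrix.fromRows (diffMat R (k + 1) k) (1 - idemMat R k)

variable [AddCommGroup V] [Module ℂ V] (ρ : Representation ℂ Γ V)

variable {R k} in
lemma matAct_diffMat {l : ℕ} [DecidableEq (ι l)] [Fintype (ι l)] {v : ι l → V} {w : ι k → V} :
    matAct (repAct ρ) (diffMat R k l) v = w ↔ R.δ k l ≫ lift ρ v = lift ρ w := by
  rw [diffMat, ← eval_comp_lift]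
  refine ⟨fun h => eval_injective (h.trans (eval_lift w).symm), fun h => ?_⟩
  exact (congrArg eval h).trans (eval_lift w)

variable {R k} in
lemma matAct_idemMat [DecidableEq (ι k)] [Fintype (ι k)] {v w : ι k → V} :
    matAct (repAct ρ) (idemMat R k) v = w ↔ R.idem k ≫ lift ρ v = lift ρ w := by
  rw [idemMat, ← eval_comp_lift]
  refine ⟨fun h => eval_injective (h.trans (eval_lift w).symm), fun h => ?_⟩
  exact (congrArg eval h).trans (eval_lift w)

variable {R k} in
lemma exists_diffMat {l : ℕ} [DecidableEq (ι l)] [Fintype (ι l)] {w : ι k → V} :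
    (∃ v : ι l → V, matAct (repAct ρ) (diffMat R k l) v = w) ↔ ∃ u, R.δ k l ≫ u = lift ρ w := by
  constructor
  · rintro ⟨v, hv⟩
    exact ⟨_, (matAct_diffMat ρ).1 hv⟩
  · rintro ⟨u, hu⟩
    refine ⟨eval (ι := ι l) u, (matAct_diffMat ρ).2 ?_⟩
    rw [← hu]
    exact congrArg (R.δ k l ≫ ·) (lift_eval (ι := ι l) u)

lemma matAct_cocycleMat [DecidableEq (ι k)] [Fintype (ι k)] (v : ι k → V) :
    matAct (repAct ρ) (cocycleMat R k) v =
      Sum.elim (matAct (repAct ρ) (diffMat R (k + 1) k) v)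
        (v - matAct (repAct ρ) (idemMat R k) v) := by
  rw [cocycleMat, matAct_fromRows, matAct_sub, matAct_one]

variable {R k} in
lemma matAct_cocycleMat_eq_zero [DecidableEq (ι k)] [Fintype (ι k)] {v : ι k → V} :
    matAct (repAct ρ) (cocycleMat R k) v = 0 ↔
      R.δ (k + 1) k ≫ lift ρ v = 0 ∧ R.idem k ≫ lift ρ v = lift ρ v := by
  rw [matAct_cocycleMat, ← matAct_idemMat, ← lift_zero (ι := ι (k + 1)), ← matAct_diffMat]
  constructor
  · intro h
    exact ⟨funext fun j => congrFun h (.inl j),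
      (sub_eq_zero.1 (funext fun j => congrFun h (.inr j))).symm⟩
  · rintro ⟨h, h'⟩
    rw [h, h', sub_self, Sum.elim_zero_zero]

variable [∀ j, DecidableEq (ι j)] [Fintype (ι k)]

lemma cocycleMat_mul_diffMat : cocycleMat R k * diffMat R k (k - 1) = 0 := by
  have h1 : diffMat R (k + 1) k * diffMat R k (k - 1) = 0 := by
    refine (toMat_comp (R.δ (k + 1) k) (R.δ k (k - 1))).symm.trans ?_
    exact (congrArg toMat (R.δ_comp_δ k)).trans toMat_zero
  have h2 : idemMat R k * diffMat R k (k - 1) = diffMat R k (k - 1) :=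
    (toMat_comp (R.idem k) (R.δ k (k - 1))).symm.trans (congrArg toMat (R.idem_comp_δ k (k - 1)))
  rw [cocycleMat, Matrix.fromRows_mul, h1, Matrix.sub_mul, h2, Matrix.one_mul, sub_self]
  ext (j | j) i <;> rfl

variable {R k} in
lemma cohomologyVanishes_iff_matAct [Fintype (ι (k - 1))]
    (e : HomotopyEquiv P (Rep.barComplex ℚ Γ)) :
    CohomologyVanishes ρ k ↔ ∀ v, matAct (repAct ρ) (cocycleMat R k) v = 0 →
      ∃ u, matAct (repAct ρ) (diffMat R k (k - 1)) u = v := by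
  rw [cohomologyVanishes_iff_homExact]
  have h : (Rep.barComplex ℚ Γ).HomExact (ratRep ρ) k ↔ P.HomExact (ratRep ρ) k :=
    ⟨fun h => .of_homotopyEquiv e h, fun h => .of_homotopyEquiv e.symm h⟩
  rw [h, R.homExact_iff]
  constructor
  · intro h v hv
    obtain ⟨h1, h2⟩ := (matAct_cocycleMat_eq_zero ρ).1 hv
    exact (exists_diffMat ρ).2 (h _ h1 h2)
  · intro h v h1 h2
    have hv : lift ρ (eval (ι := ι k) v) = v := lift_eval (ι := ι k) v
    rw [← hv] at h1 h2 ⊢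
    exact (exists_diffMat ρ).1 (h _ ((matAct_cocycleMat_eq_zero ρ).2 ⟨h1, h2⟩))

variable {R k} in
-- The matrix sends `v` to `(δ v, v - idem v)`. Since `δ` only sees `idem v`, the two components
-- vary independently and the range is a product. Thus closedness for `D'` concerns the actual
-- coboundaries.
lemma mem_range_cocycleMat {w : ι (k + 1) → V} {x : ι k → V} :
    (∃ v, matAct (repAct ρ) (cocycleMat R k) v = Sum.elim w x) ↔
      (∃ u, R.δ (k + 1) k ≫ u = lift ρ w) ∧ matAct (repAct ρ) (idemMat R k) x = 0 := by
  rw [← exists_diffMat]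
  have hi (v : ι k → V) : matAct (repAct ρ) (idemMat R k) (matAct (repAct ρ) (idemMat R k) v) =
      matAct (repAct ρ) (idemMat R k) v := by
    rw [← matAct_mul]
    congr 2
    exact (toMat_comp (R.idem k) (R.idem k)).symm.trans (congrArg toMat (R.idem_comp_idem k))
  have hd (v : ι k → V) :
      matAct (repAct ρ) (diffMat R (k + 1) k) (matAct (repAct ρ) (idemMat R k) v) =
      matAct (repAct ρ) (diffMat R (k + 1) k) v := by
    rw [← matAct_mul]
    congr 2
    exact (toMat_comp (R.δ (k + 1) k) (R.idem k)).symm.trans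
      (congrArg toMat (R.δ_comp_idem (k + 1) k))
  constructor
  · rintro ⟨v, hv⟩
    rw [matAct_cocycleMat] at hv
    have h1 : matAct (repAct ρ) (diffMat R (k + 1) k) v = w := funext fun j => congrFun hv (.inl j)
    have h2 : v - matAct (repAct ρ) (idemMat R k) v = x := funext fun j => congrFun hv (.inr j)
    refine ⟨⟨v, h1⟩, ?_⟩
    rw [← h2, map_sub, hi, sub_self]
  · rintro ⟨⟨u, hu⟩, hx⟩
    refine ⟨matAct (repAct ρ) (idemMat R k) u + x, ?_⟩
    rw [matAct_cocycleMat, map_add, map_add, hd, hi, hu, hx, ← hd x, hx, map_zero]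
    simp

section Topology

variable {V : Type} [NormedAddCommGroup V] [NormedSpace ℂ V] (ρ : Representation ℂ Γ V)

omit [∀ j, DecidableEq (ι j)] [Fintype (ι k)] in
lemma continuous_app_lift {β : Type} (hρ : ∀ g, Continuous (ρ g)) (x : Rep.free ℚ Γ β) :
    Continuous fun v : β → V => app (lift ρ v) x := by
  induction x using Finsupp.induction_linear with
  | zero => simpa using continuous_const
  | add x y hx hy => simp only [map_add]; exact hx.add hy
  | single j x =>
    induction x using MonoidAlgebra.induction_linear with
    | zero => simpa using continuous_const
    | add x y hx hy => simp only [Finsupp.single_add, map_add]; exact hx.add hy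
    | single g q =>
      refine (((hρ g).comp (continuous_apply j)).const_smul (q : ℂ)).congr fun v => ?_
      exact (app_lift_single v j g q).symm

variable {R k} in
-- Pulling back along the homotopy equivalence sends bar cochains to tuples continuously for
-- pointwise convergence, because each component involves finitely many values. A cocycle is a
-- coboundary exactly when its image, paired with 0, lies in the closed range.
lemma hausdorffCohomology_of_isClosed_range (e : HomotopyEquiv P (Rep.barComplex ℚ Γ))
    (hρ : ∀ g, Continuous (ρ g))
    (hc : IsClosed (Set.range (matAct (repAct ρ) (cocycleMat R k)))) :
    HausdorffCohomology ρ (k + 1) := by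
  let T : ((Fin (k + 1) → Γ) → V) → ι (k + 1) → V := fun z =>
    eval (ι := ι (k + 1)) (R.r (k + 1) ≫ e.hom.f (k + 1) ≫ lift ρ z)
  have hT : Continuous T := continuous_pi fun j => continuous_app_lift ρ hρ
    ((R.r (k + 1) ≫ e.hom.f (k + 1)).hom (Finsupp.single j (MonoidAlgebra.single 1 1)))
  have hT' : Continuous fun z => (Sum.elim (T z) 0 : ι (k + 1) ⊕ ι k → V) := by
    refine continuous_pi fun j => ?_
    cases j with
    | inl j => exact (continuous_apply j).comp hT
    | inr j => exact continuous_const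
  refine hausdorffCohomology_of_isClosed ρ (hc.preimage hT') fun z hz => ?_
  have h1 := R.exists_iff e (lift ρ z) (barComplex_d_comp_lift_eq_zero_iff.2 hz)
  have h2 : lift ρ (T z) = R.r (k + 1) ≫ e.hom.f (k + 1) ≫ lift ρ z :=
    lift_eval (ι := ι (k + 1)) _
  rw [← h2] at h1
  refine (exists_barComplex_d_iff (ρ := ρ)).symm.trans (h1.trans ?_)
  refine Iff.trans ?_ (mem_range_cocycleMat ρ (R := R) (w := T z) (x := 0)).symm
  simp

variable {R k} in
-- When the next cohomology group vanishes, the coboundaries are all the cocycles, which form the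
-- kernel of a continuous map.
lemma isClosed_range_of_cohomologyVanishes [Fintype (ι (k + 1))]
    (e : HomotopyEquiv P (Rep.barComplex ℚ Γ))
    (hρ : ∀ g, Continuous (ρ g)) (h : CohomologyVanishes ρ (k + 1)) :
    IsClosed (Set.range (matAct (repAct ρ) (cocycleMat R k))) := by
  let : Fintype (ι (k + 1 - 1)) := ‹Fintype (ι k)›
  have hr : Set.range (matAct (repAct ρ) (cocycleMat R k)) =
      {y : ι (k + 1) ⊕ ι k → V | matAct (repAct ρ) (cocycleMat R (k + 1)) (y ∘ .inl) = 0} ∩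
        {y | matAct (repAct ρ) (idemMat R k) (y ∘ .inr) = 0} := by
    ext y
    obtain ⟨w, x, rfl⟩ : ∃ w x, y = Sum.elim w x := ⟨y ∘ .inl, y ∘ .inr, by simp⟩
    refine (mem_range_cocycleMat ρ).trans (and_congr_left fun _ => ?_)
    rw [← exists_diffMat]
    constructor
    · rintro ⟨u, rfl⟩
      have h1 := congrArg (fun M => matAct (repAct ρ) M u) (cocycleMat_mul_diffMat R (k + 1))
      exact (matAct_mul (repAct ρ) _ _ u).symm.trans (h1.trans (matAct_zero _ _))
    · intro hw
      exact (cohomologyVanishes_iff_matAct ρ e).1 h w hw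
  rw [hr]
  have hc {b a : Type} [Fintype a] (M : Matrix b a (GroupAlg Γ)) :=
    continuous_matAct (repAct ρ) (continuous_repAct ρ hρ) M
  refine .inter (isClosed_singleton.preimage ((hc _).comp ?_))
    (isClosed_singleton.preimage ((hc _).comp ?_)) <;> fun_prop

end Topology

end Retracts

section Finiteness

variable {Γ : Type} [Group Γ]

lemma epi_freeLift (X : Rep.{0} ℚ Γ) (s : Set X.ρ.asModule)
    (hs : Submodule.span (MonoidAlgebra ℚ Γ) s = ⊤) :
    Epi (Rep.freeLift (A := X) ℚ Γ (fun i : s => X.ρ.asModuleEquiv i)) := by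
  rw [Rep.epi_iff_surjective]
  intro x
  set f := (Rep.freeLift (A := X) ℚ Γ (fun i : s => X.ρ.asModuleEquiv i)).hom
  have hx : X.ρ.asModuleEquiv.symm x ∈ Submodule.span (MonoidAlgebra ℚ Γ) s := by
    rw [hs]; trivial
  obtain ⟨x, rfl⟩ := X.ρ.asModuleEquiv.surjective x
  rw [LinearEquiv.symm_apply_apply] at hx
  induction hx using Submodule.span_induction with
  | mem x hx =>
    refine ⟨Finsupp.single ⟨x, hx⟩ (.single 1 1), ?_⟩
    refine (Representation.freeLift_single_single X.ρ _ _ _ _).trans ?_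
    rw [map_one, one_smul]
    rfl
  | zero => exact ⟨0, map_zero f⟩
  | add x y _ _ hx hy =>
    obtain ⟨x, rfl⟩ := hx
    obtain ⟨y, rfl⟩ := hy
    exact ⟨x + y, map_add f x y⟩
  | smul a x _ hx =>
    obtain ⟨w, hw⟩ := hx
    induction a using MonoidAlgebra.induction_linear with
    | zero => exact ⟨0, by rw [zero_smul, map_zero]; exact map_zero f⟩
    | add a b ha hb =>
      obtain ⟨y, hy⟩ := ha
      obtain ⟨z, hz⟩ := hb
      exact ⟨y + z, (map_add f y z).trans (by rw [hy, hz, add_smul, map_add])⟩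
    | single g q =>
      refine ⟨q • (Rep.free ℚ Γ s).ρ g w, ?_⟩
      refine (map_smul f q _).trans ?_
      rw [Representation.single_smul]
      refine congrArg (q • ·) ?_
      refine (Rep.hom_comm_apply _ g w).trans ?_
      exact congrArg (X.ρ g) hw

/-- Each term is covered by the free module on a generating set, finite whenever possible, and
projectivity splits the cover. -/
lemma exists_retracts (P : ChainComplex (Rep.{0} ℚ Γ) ℕ) (hP : ∀ j, Projective (P.X j)) :
    ∃ ι : ℕ → Type, Nonempty (P.Retracts fun j => Rep.free ℚ Γ (ι j)) ∧
      ∀ j, Module.Finite (MonoidAlgebra ℚ Γ) (P.X j).ρ.asModule → Finite (ι j) := by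
  have h1 (j : ℕ) : ∃ s : Set (P.X j).ρ.asModule, Submodule.span (MonoidAlgebra ℚ Γ) s = ⊤ ∧
      (Module.Finite (MonoidAlgebra ℚ Γ) (P.X j).ρ.asModule → s.Finite) := by
    by_cases h : Module.Finite (MonoidAlgebra ℚ Γ) (P.X j).ρ.asModule
    · obtain ⟨s, hs⟩ := h.fg_top
      exact ⟨s, hs, fun _ => s.finite_toSet⟩
    · exact ⟨Set.univ, Submodule.span_univ, fun h' => absurd h' h⟩
  choose s hs hf using h1
  have hE (j : ℕ) := epi_freeLift (P.X j) (s j) (hs j)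
  exact ⟨fun j => s j, ⟨{
    r := fun j => Rep.freeLift (A := P.X j) ℚ Γ (fun i : s j => (P.X j).ρ.asModuleEquiv i)
    i := fun j => Projective.factorThru (𝟙 _) _
    i_r := fun j => Projective.factorThru_comp _ _ }⟩, fun j hj => hf j hj⟩

end Finiteness

end ratRep

/-- Cohomology in terms of two matrices over the group algebra: `D` for the differential into
degree `k`, and `D'` whose kernel is the space of cocycles in degree `k`. -/
structure IsCohomologyPresentation {Γ a b c : Type} [Group Γ] [Fintype a] [Fintype b]
    (k : ℕ) (D : Matrix b a (GroupAlg Γ)) (D' : Matrix c b (GroupAlg Γ)) : Prop where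
  mul_eq_zero : D' * D = 0
  cohomologyVanishes_iff : ∀ {V : Type} [AddCommGroup V] [Module ℂ V] (ρ : Representation ℂ Γ V),
    CohomologyVanishes ρ k ↔
      ∀ v, matAct (repAct ρ) D' v = 0 → ∃ u, matAct (repAct ρ) D u = v
  hausdorffCohomology : ∀ {V : Type} [NormedAddCommGroup V] [NormedSpace ℂ V]
    (ρ : Representation ℂ Γ V), (∀ g, Continuous (ρ g)) →
      IsClosed (Set.range (matAct (repAct ρ) D')) → HausdorffCohomology ρ (k + 1)
  isClosed_range : ∀ {V : Type} [NormedAddCommGroup V] [NormedSpace ℂ V]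
    (ρ : Representation ℂ Γ V), (∀ g, Continuous (ρ g)) → CohomologyVanishes ρ (k + 1) →
      IsClosed (Set.range (matAct (repAct ρ) D'))
  eq_zero : k = 0 → D = 0

theorem IsFPRat.exists_isCohomologyPresentation {Γ : Type} [Group Γ] {k : ℕ}
    (h : IsFPRat Γ (k + 1)) :
    ∃ (a b c : Type) (_ : Fintype a) (_ : Fintype b) (_ : Fintype c)
      (D : Matrix b a (GroupAlg Γ)) (D' : Matrix c b (GroupAlg Γ)),
      IsCohomologyPresentation k D D' := by
  classical
  obtain ⟨P, hP⟩ := h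
  obtain ⟨ι, ⟨R⟩, hf⟩ := ratRep.exists_retracts P.complex P.projective
  have e : HomotopyEquiv P.complex (Rep.barComplex ℚ Γ) := P.homotopyEquiv (Rep.barResolution ℚ Γ)
  have : Fintype (ι (k - 1)) := @Fintype.ofFinite _ (hf _ (hP _ (by omega)))
  have : Fintype (ι k) := @Fintype.ofFinite _ (hf _ (hP _ (by omega)))
  have : Fintype (ι (k + 1)) := @Fintype.ofFinite _ (hf _ (hP _ le_rfl))
  -- The rows indexed by `ι (k + 1)` impose the cocycle condition and those indexed by `ι k`
  -- membership in the retract. For `k = 0` the incoming matrix is square but zero.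
  refine ⟨ι (k - 1), ι k, ι (k + 1) ⊕ ι k, inferInstance, inferInstance, inferInstance,
    ratRep.diffMat R k (k - 1), ratRep.cocycleMat R k,
    { mul_eq_zero := ratRep.cocycleMat_mul_diffMat R k
      cohomologyVanishes_iff := fun ρ => ratRep.cohomologyVanishes_iff_matAct ρ e
      hausdorffCohomology := fun ρ hρ => ratRep.hausdorffCohomology_of_isClosed_range ρ e hρ
      isClosed_range := fun ρ hρ => ratRep.isClosed_range_of_cohomologyVanishes ρ e hρ
      eq_zero := ?_ }⟩
  rintro rfl
  have h0 : R.δ 0 (0 - 1) = 0 := by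
    rw [ChainComplex.Retracts.δ, ChainComplex.d_zero_pred, Limits.zero_comp, Limits.comp_zero]
  exact (congrArg ratRep.toMat h0).trans ratRep.toMat_zero

/-! ### Homology by conjugate duality. -/

section Chains

variable {Γ V : Type} [Group Γ] [AddCommGroup V] [Module ℂ V] (ρ : Representation ℂ Γ V)

/-- The differential of inhomogeneous chains. -/
def chainD (k l : ℕ) : ((Fin k → Γ) →₀ V) →ₗ[ℂ] ((Fin l → Γ) →₀ V) :=
  ((groupHomology.inhomogeneousChains (Rep.of ρ)).d k l).hom

lemma chainD_succ_single (k : ℕ) (g : Fin (k + 1) → Γ) (v : V) :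
    chainD ρ (k + 1) k (Finsupp.single g v) =
      Finsupp.single (fun i => g i.succ) (ρ (g 0)⁻¹ v) +
        ∑ j : Fin (k + 1), (-1 : ℂ) ^ ((j : ℕ) + 1) •
          Finsupp.single (Fin.contractNth j (· * ·) g) v := by
  have h : (groupHomology.inhomogeneousChains (Rep.of ρ)).d (k + 1) k = _ :=
    groupHomology.inhomogeneousChains.d_def (Rep.of ρ) k
  rw [chainD, h]
  exact groupHomology.inhomogeneousChains.d_single (A := Rep.of ρ) k g v

lemma homologyVanishes_of_exact (k : ℕ)
    (h : ∀ x, chainD ρ k (k - 1) x = 0 → ∃ y, chainD ρ (k + 1) k y = x) :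
    HomologyVanishes ρ k := by
  have hk : (ComplexShape.down ℕ).next k = k - 1 := by cases k <;> simp
  have hex : (groupHomology.inhomogeneousChains (Rep.of ρ)).ExactAt k := by
    rw [HomologicalComplex.exactAt_iff' _ (k + 1) k (k - 1) (by simp) hk,
      ShortComplex.moduleCat_exact_iff]
    exact h
  exact ModuleCat.subsingleton_of_isZero
    ((HomologicalComplex.exactAt_iff_isZero_homology _ _).1 hex)

end Chains

section Duality

variable {Γ V : Type} [Group Γ] [AddCommGroup V] [Module ℂ V] (ρ : Representation ℂ Γ V)

/-- The conjugate-linear functionals on `V`. -/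
abbrev ConjDual (V : Type) [AddCommGroup V] [Module ℂ V] : Type := V →ₗ⋆[ℂ] ℂ

/-- The pairing of cochains with values in the conjugate dual and chains. -/
def pairing {k : ℕ} (z : (Fin k → Γ) → ConjDual V) : ((Fin k → Γ) →₀ V) →+ ℂ :=
  Finsupp.liftAddHom fun g => (z g).toAddMonoidHom

omit [Group Γ] in
lemma pairing_single {k : ℕ} (z : (Fin k → Γ) → ConjDual V) (g : Fin k → Γ) (v : V) :
    pairing z (Finsupp.single g v) = z g v := Finsupp.liftAddHom_apply_single _ _ _

omit [Group Γ] in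
lemma pairing_zero {k : ℕ} (x : (Fin k → Γ) →₀ V) :
    pairing (0 : (Fin k → Γ) → ConjDual V) x = 0 := by
  induction x using Finsupp.induction_linear with
  | zero => simp
  | add x y hx hy => rw [map_add, hx, hy, add_zero]
  | single g v => rw [pairing_single]; rfl

lemma neg_one_pow_conj (j : ℕ) : starRingEnd ℂ ((-1 : ℂ) ^ j) = (-1) ^ j := by simp

/-- The differentials of chains and of cochains with values in the conjugate dual are adjoint. -/
lemma pairing_cochainD {ρ' : Representation ℂ Γ (ConjDual V)}
    (hρ : ∀ g φ v, ρ' g φ v = φ (ρ g⁻¹ v)) {k : ℕ} (z : (Fin k → Γ) → ConjDual V)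
    (x : (Fin (k + 1) → Γ) →₀ V) :
    pairing (cochainD ρ' k (k + 1) z) x = pairing z (chainD ρ (k + 1) k x) := by
  induction x using Finsupp.induction_linear with
  | zero => simp
  | add x y hx hy => rw [map_add, map_add, map_add, hx, hy]
  | single g v =>
    rw [pairing_single, cochainD_succ_apply, chainD_succ_single, map_add, pairing_single,
      LinearMap.add_apply, hρ, map_sum, LinearMap.sum_apply]
    congr 1
    refine Finset.sum_congr rfl fun j _ => ?_
    rw [Finsupp.smul_single, pairing_single, map_smulₛₗ, neg_one_pow_conj, LinearMap.smul_apply]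

/-- Vanishing of cohomology of the conjugate dual implies vanishing of homology. -/
theorem HomologyVanishes.of_conjDual {ρ' : Representation ℂ Γ (ConjDual V)}
    (hρ : ∀ g φ v, ρ' g φ v = φ (ρ g⁻¹ v)) {k : ℕ} (h : CohomologyVanishes ρ' k) :
    HomologyVanishes ρ k := by
  refine homologyVanishes_of_exact ρ k fun x hx => ?_
  by_contra hx'
  -- A cycle that is not a boundary is detected by a functional vanishing on boundaries. The
  -- conjugate of this functional is a cocycle in the conjugate dual. A primitive of it would give
  -- `x` the value zero by adjointness.
  obtain ⟨f, hf, hf'⟩ := Submodule.exists_le_ker_of_notMem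
    (p := LinearMap.range (chainD ρ (k + 1) k)) (v := x) hx'
  let z : (Fin k → Γ) → ConjDual V := fun g =>
    { toFun := fun v => starRingEnd ℂ (f (Finsupp.single g v))
      map_add' := fun v w => by rw [Finsupp.single_add, map_add, map_add]
      map_smul' := fun c v => by rw [← Finsupp.smul_single, map_smul, smul_eq_mul, map_mul]; rfl }
  have hz (y : (Fin k → Γ) →₀ V) : pairing z y = starRingEnd ℂ (f y) := by
    induction y using Finsupp.induction_linear with
    | zero => simp
    | add x y hx hy => rw [map_add, hx, hy, map_add, map_add]
    | single g v => rw [pairing_single]; rfl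
  have hdz : cochainD ρ' k (k + 1) z = 0 := by
    ext g v
    rw [← pairing_single (cochainD ρ' k (k + 1) z) g v, pairing_cochainD ρ hρ, hz]
    have h1 : f (chainD ρ (k + 1) k (Finsupp.single g v)) = 0 := hf' ⟨_, rfl⟩
    rw [h1, map_zero]
    rfl
  obtain ⟨y, hy⟩ := (cohomologyVanishes_iff ρ' k).1 h z hdz
  refine hf ((map_eq_zero (starRingEnd ℂ)).1 ?_)
  rw [← hz, ← hy]
  cases k with
  | zero => rw [cochainD_zero_pred, pairing_zero]
  | succ k => exact (pairing_cochainD ρ hρ y x).trans ((congrArg (pairing y) hx).trans (map_zero _))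

variable {A : Type} [Ring A] [StarRing A] [Algebra ℂ A] [StarModule ℂ A]

/-- The conjugate dual of a module over a ⋆-algebra. -/
def conjDualAct (m : A →ₐ[ℂ] Module.End ℂ V) : A →ₐ[ℂ] Module.End ℂ (ConjDual V) :=
  AlgHom.ofLinearMap
    { toFun := fun a =>
        { toFun := fun φ => φ.comp (m (star a))
          map_add' := fun φ ψ => rfl
          map_smul' := fun c φ => rfl }
      map_add' := fun a b => by
        ext φ v
        simp
      map_smul' := fun c a => by
        ext φ v
        simp [map_smulₛₗ] }
    (by ext φ v; simp) (fun a b => by ext φ v; simp)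

lemma conjDualAct_apply (m : A →ₐ[ℂ] Module.End ℂ V) (a : A) (φ : ConjDual V) (v : V) :
    conjDualAct m a φ v = φ (m (star a) v) := rfl

end Duality

/-! ### Degree zero and the spectral gap. -/

section Degree

variable {Γ V : Type} [Group Γ] [AddCommGroup V] [Module ℂ V]

/-- Cohomology in degree zero consists of the invariant vectors. -/
lemma cohomologyVanishes_zero_iff (ρ : Representation ℂ Γ V) :
    CohomologyVanishes ρ 0 ↔ ∀ v, (∀ g, ρ g v = v) → v = 0 := by
  rw [cohomologyVanishes_iff]
  have hd (z : (Fin 0 → Γ) → V) (g : Fin 1 → Γ) :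
      cochainD ρ 0 1 z g = ρ (g 0) (z default) - z default := by
    rw [cochainD_succ_apply, sub_eq_add_neg]
    simp [Subsingleton.elim _ (default : Fin 0 → Γ)]
  constructor
  · intro h v hv
    obtain ⟨y, hy⟩ := h (fun _ => v) (funext fun g => (hd _ g).trans (sub_eq_zero.2 (hv _)))
    rw [cochainD_zero_pred] at hy
    exact (congrFun hy default).symm
  · intro h z hz
    refine ⟨0, ?_⟩
    rw [map_zero]
    ext x
    rw [Subsingleton.elim x default]
    refine (h _ fun g => sub_eq_zero.1 ?_).symm
    exact (hd z fun _ => g).symm.trans (congrFun hz _)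

lemma UnitaryRep.cohomologyVanishes_zero_iff (σ : UnitaryRep Γ) :
    CohomologyVanishes σ.rep 0 ↔ σ.NoInvariants := _root_.cohomologyVanishes_zero_iff σ.rep

lemma UnitaryRep.matAct_triv {a b : Type} [Fintype a] (D : Matrix b a (GroupAlg Γ)) (v : a → ℂ) :
    (UnitaryRep.triv Γ).mat D v = (D.map GroupAlg.augmentation).mulVec v := by
  ext j
  refine Finset.sum_congr rfl fun i _ => ?_
  exact ((UnitaryRep.triv Γ).repAct_rep _ _).trans (GroupAlg.act_triv _ _)

lemma UnitaryRep.not_noInvariants_triv : ¬ (UnitaryRep.triv Γ).NoInvariants := fun h =>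
  one_ne_zero (α := ℂ) (h (1 : ℂ) fun _ => rfl)

end Degree

section Gap

open MaxCStar Matrix

variable {Γ : Type} [Group Γ] {n : ℕ}

lemma HasBracketT.hasParenT (h : HasBracketT Γ n) : HasParenT Γ n := fun σ _ => h σ

/-- Property `(Tₙ)` yields a spectral gap. -/
theorem HasParenT.exists_column (hΓ : IsFPRat Γ 1) (hn : 1 ≤ n) (h : HasParenT Γ n) :
    ∃ (c : Type) (_ : Fintype c) (Y : Matrix c Unit (GroupAlg Γ)),
      (∀ j i, GroupAlg.augmentation (Y j i) = 0) ∧ UnitaryRep.BoundedBelow Y := by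
  obtain ⟨a, b, c, _, _, _, D, D', hD⟩ := hΓ.exists_isCohomologyPresentation
  have hiff (σ : UnitaryRep Γ) : σ.NoInvariants ↔ ∀ v, σ.mat D' v = 0 → v = 0 := by
    rw [← σ.cohomologyVanishes_zero_iff, hD.cohomologyVanishes_iff]
    refine forall₂_congr fun v _ => ?_
    rw [hD.eq_zero rfl]
    simp only [matAct_zero, exists_const, eq_comm]
  -- In degree 0 injectivity of `D'` means that there are no invariant vectors, so it fails for the
  -- trivial representation.
  obtain ⟨ε, hε, hε0⟩ : ∃ ε : b → ℂ, (UnitaryRep.triv Γ).mat D' ε = 0 ∧ ε ≠ 0 := by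
    by_contra! hcon
    exact UnitaryRep.not_noInvariants_triv ((hiff _).2 hcon)
  rw [UnitaryRep.matAct_triv] at hε
  refine ⟨c, inferInstance, UnitaryRep.exists_column_boundedBelow D' (fun σ hσ => ⟨?_, ?_⟩) hε0
    fun j => congrFun hε j⟩
  · exact (injective_iff_map_eq_zero _).2 ((hiff σ).1 hσ)
  -- The assumption `1 ≤ n` enters here: vanishing of `H¹` closes the range of the degree 0
  -- differential.
  · exact hD.isClosed_range σ.rep σ.continuous_rep (h σ hσ 1 le_rfl hn)

lemma HasParenT.cohomologyVanishes (h : HasParenT Γ n) {σ : UnitaryRep Γ} (hσ : σ.NoInvariants)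
    {k : ℕ} (hk : k ≤ n) : CohomologyVanishes σ.rep k := by
  cases k with
  | zero => exact σ.cohomologyVanishes_zero_iff.2 hσ
  | succ k => exact h σ hσ _ (by omega) hk

/-- Property `(Tₙ)` yields a Kazhdan projection and contracting homotopies on its complement. -/
theorem HasParenT.exists_isKazhdanProjection (hΓ : IsFPRat Γ 1) (hn : 1 ≤ n) (h : HasParenT Γ n) :
    ∃ p : MaxCStar Γ, IsKazhdanProjection p ∧
      ∀ {a b c : Type} [Fintype a] [Fintype b] [Fintype c] [DecidableEq b] {k : ℕ}
        {D : Matrix b a (GroupAlg Γ)} {D' : Matrix c b (GroupAlg Γ)},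
        IsCohomologyPresentation k D D' → k ≤ n →
          ∃ (X : Matrix a b (MaxCStar Γ)) (Y : Matrix b c (MaxCStar Γ)),
            mapMat D * X + Y * mapMat D' = scal b (1 - p) := by
  obtain ⟨d, _, Y, hY, hYb⟩ := h.exists_column hΓ hn
  obtain ⟨p, hp⟩ := MaxCStar.exists_isKazhdanProjection hY hYb
  refine ⟨p, hp, fun {a b c} _ _ _ _ k D D' hD hk => ?_⟩
  exact hp.exists_homotopy D D' hD.mul_eq_zero <|
    UnitaryRep.boundedBelow_of_exact hY hYb D D' fun σ hσ =>
      (hD.cohomologyVanishes_iff σ.rep).1 (h.cohomologyVanishes hσ hk)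

end Gap

/-! ### From matrix identities over `C⋆Γ` to modules. -/

section Modules

open MaxCStar

variable {Γ V : Type} [Group Γ] {a b c : Type} [Fintype a]

section Algebraic

variable [AddCommGroup V] [Module ℂ V] (m : MaxCStar Γ →ₐ[ℂ] Module.End ℂ V)

lemma matAct_cstarRep (D : Matrix b a (GroupAlg Γ)) :
    matAct (repAct (cstarRep m)) D = matAct m (mapMat D) := by
  rw [repAct_eq_of (φ := m.comp coeHom) fun _ => rfl]
  rfl

/-- A contracting homotopy makes the cohomology of modules vanish. -/
theorem IsCohomologyPresentation.cohomologyVanishes_cstarRep [Fintype b] [Fintype c] [DecidableEq b]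
    {k : ℕ} {D : Matrix b a (GroupAlg Γ)} {D' : Matrix c b (GroupAlg Γ)}
    (hD : IsCohomologyPresentation k D D') {X : Matrix a b (MaxCStar Γ)}
    {Y : Matrix b c (MaxCStar Γ)} {q : MaxCStar Γ}
    (hXY : mapMat D * X + Y * mapMat D' = scal b q) (hq : m q = 1) :
    CohomologyVanishes (cstarRep m) k := by
  refine (hD.cohomologyVanishes_iff _).2 fun v hv => ⟨matAct m X v, ?_⟩
  rw [matAct_cstarRep] at hv ⊢
  have h1 := congrArg (fun M => matAct m M v) hXY
  simp only [matAct_add, matAct_mul, hv, map_zero, add_zero] at h1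
  rw [h1]
  ext i
  rw [matAct_diagonal, hq, Module.End.one_apply]

lemma cstarRep_conjDualAct (g : Γ) (φ : ConjDual V) (v : V) :
    cstarRep (conjDualAct m) g φ v = φ (cstarRep m g⁻¹ v) := by
  change φ (m (star (MaxCStar.of g)) v) = φ (m (MaxCStar.of g⁻¹) v)
  rw [← coeHom_of, ← coeHom_of, coeHom_apply, star_coe, GroupAlg.star_of, coeHom_apply]

/-- The conjugate dual is again a `C⋆Γ`-module, so the vanishing of cohomology applies to it.
Self-adjointness of `q` ensures that `q` acts as the identity there too. -/
theorem IsCohomologyPresentation.homologyVanishes_cstarRep [Fintype b] [Fintype c] [DecidableEq b]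
    {k : ℕ} {D : Matrix b a (GroupAlg Γ)} {D' : Matrix c b (GroupAlg Γ)}
    (hD : IsCohomologyPresentation k D D') {X : Matrix a b (MaxCStar Γ)}
    {Y : Matrix b c (MaxCStar Γ)} {q : MaxCStar Γ}
    (hXY : mapMat D * X + Y * mapMat D' = scal b q) (hq : m q = 1) (hq' : star q = q) :
    HomologyVanishes (cstarRep m) k := by
  refine .of_conjDual _ (cstarRep_conjDualAct m)
    (hD.cohomologyVanishes_cstarRep (conjDualAct m) hXY ?_)
  ext φ v
  rw [conjDualAct_apply, hq', hq]
  rfl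

end Algebraic

/-- A quasi-inverse of the differential makes the cohomology of Banach modules Hausdorff. -/
theorem IsCohomologyPresentation.hausdorffCohomology_banachRep [Fintype b] [Fintype c] {k : ℕ}
    {D : Matrix b a (GroupAlg Γ)} {D' : Matrix c b (GroupAlg Γ)}
    (hD : IsCohomologyPresentation k D D') {G : Matrix b c (MaxCStar Γ)}
    (hG : mapMat D' * G * mapMat D' = mapMat D') [NormedAddCommGroup V] [NormedSpace ℂ V]
    (m : MaxCStar Γ →ₐ[ℂ] (V →L[ℂ] V)) : HausdorffCohomology (banachRep m) (k + 1) := by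
  refine hD.hausdorffCohomology _ (fun g => (m (MaxCStar.of g)).continuous) ?_
  have hc {b a : Type} [Fintype a] (M : Matrix b a (MaxCStar Γ)) :=
    continuous_matAct ((opIncl V).comp m) (fun x => (m x).continuous) M
  rw [banachRep, matAct_cstarRep]
  have hr : Set.range (matAct ((opIncl V).comp m) (mapMat D')) =
      {w | matAct ((opIncl V).comp m) (mapMat D') (matAct ((opIncl V).comp m) G w) = w} := by
    ext w
    constructor
    · rintro ⟨v, rfl⟩
      have h1 := congrArg (fun M => matAct ((opIncl V).comp m) M v) hG
      simp only [matAct_mul] at h1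
      exact h1
    · intro hw
      exact ⟨_, hw⟩
  rw [hr]
  exact isClosed_eq ((hc _).comp (hc _)) continuous_id

end Modules

/-! ### The augmentation ideal as a unital algebra, and its modules. -/

namespace MaxCStar

variable {Γ : Type} [Group Γ]

lemma augmentation_star (x : MaxCStar Γ) :
    augmentation (star x) = starRingEnd ℂ (augmentation x) := by
  induction x using induction_coeHom with
  | hP =>
    exact isClosed_eq (continuous_augmentation.comp continuous_star')
      (continuous_star.comp continuous_augmentation)
  | h x =>
    rw [coeHom_apply, star_coe, ← coeHom_apply, ← coeHom_apply, augmentation_coeHom,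
      augmentation_coeHom]
    induction x using GroupAlg.induction with
    | h1 g => rw [GroupAlg.star_of, GroupAlg.augmentation_of, GroupAlg.augmentation_of, map_one]
    | h2 x y hx hy => rw [star_add, map_add, map_add, map_add, hx, hy]
    | h3 c x hx => rw [star_smul, map_smul, map_smul, smul_eq_mul, smul_eq_mul, map_mul, hx]; rfl

/-- The augmentation of `star p` is 1, so `star p * p = p`, and the left side is self-adjoint. -/
lemma IsKazhdanProjection.star_eq {p : MaxCStar Γ} (hp : IsKazhdanProjection p) : star p = p := by
  have h1 : star p * p = p := by
    rw [hp.mul_right, augmentation_star, hp.augmentation, map_one, one_smul]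
  rw [← h1, star_mul, star_star]

/-- The complement of a Kazhdan projection, as an element of the augmentation ideal. -/
def IsKazhdanProjection.compl {p : MaxCStar Γ} (hp : IsKazhdanProjection p) : C0 Γ :=
  ⟨1 - p, by
    change MaxCStar.augmentation (1 - p) = 0
    rw [map_sub, map_one, hp.augmentation, sub_self]⟩

lemma IsKazhdanProjection.isIdentity_compl {p : MaxCStar Γ} (hp : IsKazhdanProjection p) :
    C0.IsIdentity hp.compl := by
  intro a
  have ha : MaxCStar.augmentation (a : MaxCStar Γ) = 0 := a.2
  constructor <;> ext
  · change (1 - p) * (a : MaxCStar Γ) = a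
    rw [sub_mul, one_mul, hp.mul_left, ha, zero_smul, sub_zero]
  · change (a : MaxCStar Γ) * (1 - p) = a
    rw [mul_sub, mul_one, hp.mul_right, ha, zero_smul, sub_zero]

variable {e : C0 Γ} (he : C0.IsIdentity e) {B : Type} [Ring B] [Algebra ℂ B]
  (m : C0 Γ →ₙₐ[ℂ] B) (hm : m e = 1)

/-- The product of an element with the identity of the augmentation ideal. -/
def C0.mulIdentity (e : C0 Γ) (a : MaxCStar Γ) : C0 Γ :=
  ⟨a * e, by
    have he : augmentation (e : MaxCStar Γ) = 0 := e.2
    change augmentation (a * (e : MaxCStar Γ)) = 0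
    rw [map_mul, he, mul_zero]⟩

/-- The extension of a homomorphism from the augmentation ideal to the whole algebra. -/
def C0.extend : MaxCStar Γ →ₐ[ℂ] B :=
  AlgHom.ofLinearMap
    { toFun := fun a => m (C0.mulIdentity e a)
      map_add' := fun a b => by
        rw [← map_add]
        congr 1
        ext
        exact add_mul _ _ _
      map_smul' := fun r a => by
        rw [RingHom.id_apply, ← map_smul]
        congr 1
        ext
        exact smul_mul_assoc _ _ _ }
    (by
      rw [← hm]
      refine congrArg m ?_
      ext
      exact one_mul _)
    -- Multiplicativity amounts to `a b e = (a e)(b e)`, which holds because `b e` lies in the ideal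
    -- and is fixed by its identity `e`.
    (fun a b => by
      refine Eq.trans (congrArg m ?_) (map_mul m (C0.mulIdentity e a) (C0.mulIdentity e b))
      have h1 := congrArg Subtype.val (he (C0.mulIdentity e b)).1
      change (e : MaxCStar Γ) * (b * e) = b * e at h1
      ext
      change a * b * (e : MaxCStar Γ) = a * e * (b * e)
      rw [mul_assoc a (e : MaxCStar Γ), h1, mul_assoc])

lemma C0.extend_identity : C0.extend he m hm e = 1 := by
  refine Eq.trans (congrArg m ?_) hm
  exact (he e).1

end MaxCStar

namespace UnitaryRep

open UniformSpace

variable {Γ : Type} [Group Γ] (σ : UnitaryRep Γ)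

lemma continuous_act : Continuous (GroupAlg.act σ) :=
  AddMonoidHomClass.continuous_of_bound (GroupAlg.act σ) 1 fun x => by
    rw [one_mul]
    exact GroupAlg.norm_act_le σ x

/-- The action of the maximal C⋆-algebra in a unitary representation. -/
def cstarAct : MaxCStar Γ →ₐ[ℂ] (σ.H →L[ℂ] σ.H) where
  __ := Completion.extensionHom (GroupAlg.act σ).toRingHom σ.continuous_act
  commutes' c := by
    refine (Completion.extensionHom_coe (GroupAlg.act σ).toRingHom σ.continuous_act
      (algebraMap ℂ (GroupAlg Γ) c)).trans ?_
    exact AlgHom.commutes (GroupAlg.act σ) c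

lemma banachRep_cstarAct : banachRep σ.cstarAct = σ.rep := by
  ext g v
  have h1 : σ.cstarAct (MaxCStar.of g) = σ.π g :=
    (Completion.extensionHom_coe (GroupAlg.act σ).toRingHom σ.continuous_act
      (GroupAlg.of g)).trans (GroupAlg.act_of σ g)
  exact congrArg (fun f : σ.H →L[ℂ] σ.H => f v) h1

end UnitaryRep

/-! ### Assembly of the vanishing and Hausdorff statements. -/

section Main

open MaxCStar

variable {Γ : Type} [Group Γ] {n : ℕ}

/-- Under property `(Tₙ)`, all Banach modules have Hausdorff cohomology in degree `n + 1`. -/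
theorem HasParenT.hausdorffCohomology (hΓ : IsFPInftyRat Γ) (hn : 1 ≤ n) (h : HasParenT Γ n)
    {V : Type} [NormedAddCommGroup V] [NormedSpace ℂ V] (m : MaxCStar Γ →ₐ[ℂ] (V →L[ℂ] V)) :
    HausdorffCohomology (banachRep m) (n + 1) := by
  classical
  obtain ⟨p, hp, hpD⟩ := h.exists_isKazhdanProjection (hΓ 1) hn
  obtain ⟨a, b, c, _, _, _, D, D', hD⟩ := (hΓ (n + 1)).exists_isCohomologyPresentation
  obtain ⟨X, Y, hXY⟩ := hpD hD le_rfl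
  obtain ⟨G, hG⟩ := hp.exists_quasiInverse D D' hD.mul_eq_zero hXY
  exact hD.hausdorffCohomology_banachRep hG m

/-- Under property `(Tₙ)`, there is a Kazhdan projection, and the cohomology and homology of the
modules annihilated by it vanish up to degree `n`. -/
theorem HasParenT.exists_vanishing (hΓ : IsFPInftyRat Γ) (hn : 1 ≤ n) (h : HasParenT Γ n) :
    ∃ p : MaxCStar Γ, IsKazhdanProjection p ∧
      ∀ (V : Type) [AddCommGroup V] [Module ℂ V] (m : MaxCStar Γ →ₐ[ℂ] Module.End ℂ V),
        m (1 - p) = 1 → ∀ k ≤ n,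
          CohomologyVanishes (cstarRep m) k ∧ HomologyVanishes (cstarRep m) k := by
  classical
  obtain ⟨p, hp, hpD⟩ := h.exists_isKazhdanProjection (hΓ 1) hn
  refine ⟨p, hp, fun V _ _ m hm k hk => ?_⟩
  obtain ⟨a, b, c, _, _, _, D, D', hD⟩ := (hΓ (k + 1)).exists_isCohomologyPresentation
  obtain ⟨X, Y, hXY⟩ := hpD hD hk
  exact ⟨hD.cohomologyVanishes_cstarRep m hXY hm,
    hD.homologyVanishes_cstarRep m hXY hm (by rw [star_sub, star_one, hp.star_eq])⟩

/-- Under property `[Tₙ]`, the cohomology and homology of all modules vanish up to degree `n`. -/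
theorem HasBracketT.vanishing (hΓ : IsFPInftyRat Γ) (h : HasBracketT Γ n) {V : Type}
    [AddCommGroup V] [Module ℂ V] (m : MaxCStar Γ →ₐ[ℂ] Module.End ℂ V) {k : ℕ} (hk : 1 ≤ k)
    (hkn : k ≤ n) : CohomologyVanishes (cstarRep m) k ∧ HomologyVanishes (cstarRep m) k := by
  classical
  obtain ⟨p, hp, hpD⟩ := h.hasParenT.exists_isKazhdanProjection (hΓ 1) (hk.trans hkn)
  obtain ⟨a, b, c, _, _, _, D, D', hD⟩ := (hΓ (k + 1)).exists_isCohomologyPresentation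
  obtain ⟨X₀, Y₀, hXY₀⟩ := hpD hD hkn
  -- Unlike `(Tₙ)`, property `[Tₙ]` covers the trivial representation, so the complex is also exact
  -- on the range of `p` and the homotopy extends to all of `C⋆Γ`.
  obtain ⟨X, Y, hXY⟩ := hp.exists_homotopy_of_exact D D' (fun v hv => by
    rw [← UnitaryRep.matAct_triv] at hv
    obtain ⟨u, hu⟩ := (hD.cohomologyVanishes_iff _).1 (h (UnitaryRep.triv Γ) k hk hkn) v hv
    exact ⟨u, (UnitaryRep.matAct_triv D u).symm.trans hu⟩) hXY₀
  rw [← Matrix.diagonal_one] at hXY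
  exact ⟨hD.cohomologyVanishes_cstarRep m hXY (map_one m),
    hD.homologyVanishes_cstarRep m hXY (map_one m) (star_one _)⟩

end Main

end

theorem theorem1p7 {Γ : Type} [Group Γ] (hΓ : IsFPInftyRat Γ) (n : ℕ) (hn : 1 ≤ n) :
    -- property `[Tₙ]` and `C⋆Γ`-modules
    (HasBracketT Γ n →
      (∀ (V : Type) [AddCommGroup V] [Module ℂ V] (m : MaxCStar Γ →ₐ[ℂ] Module.End ℂ V) (k : ℕ),
        1 ≤ k → k ≤ n →
          CohomologyVanishes (cstarRep m) k ∧ HomologyVanishes (cstarRep m) k) ∧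
      (∀ (V : Type) [NormedAddCommGroup V] [NormedSpace ℂ V] [CompleteSpace V]
        (m : MaxCStar Γ →ₐ[ℂ] (V →L[ℂ] V)), HausdorffCohomology (banachRep m) (n + 1))) ∧
    -- property `(Tₙ)` and `C⋆₀Γ`-modules; the algebra `C⋆₀Γ` is then unital
    (HasParenT Γ n →
      ∃ (e : MaxCStar.C0 Γ) (he : MaxCStar.C0.IsIdentity e),
        (∀ (V : Type) [AddCommGroup V] [Module ℂ V] (m : MaxCStar.C0 Γ →ₙₐ[ℂ] Module.End ℂ V)
          (hm : m e = 1) (k : ℕ), k ≤ n →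
            CohomologyVanishes (cstarZeroRep he m hm) k ∧
              HomologyVanishes (cstarZeroRep he m hm) k) ∧
        (∀ (V : Type) [NormedAddCommGroup V] [NormedSpace ℂ V] [CompleteSpace V]
          (m : MaxCStar.C0 Γ →ₙₐ[ℂ] (V →L[ℂ] V)) (hm : m e = 1),
            HausdorffCohomology (banachZeroRep he m hm) (n + 1))) ∧
    -- property `(Tₙ)` and unitary modules
    (HasParenT Γ n → ∀ σ : UnitaryRep Γ, HausdorffCohomology σ.rep (n + 1)) := by
  refine ⟨fun h => ⟨fun V _ _ m k hk hkn => h.vanishing hΓ m hk hkn, fun V _ _ _ m =>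
    h.hasParenT.hausdorffCohomology hΓ hn m⟩, fun h => ?_, fun h σ => ?_⟩
  · obtain ⟨p, hp, hv⟩ := h.exists_vanishing hΓ hn
    refine ⟨hp.compl, hp.isIdentity_compl, fun V _ _ m hm k hk => ?_, fun V _ _ _ m hm => ?_⟩
    -- The extended module sends `a` to `m (a e)`, so a group element acts through `g e`, which is
    -- the prescribed action by definition.
    · exact hv V (MaxCStar.C0.extend hp.isIdentity_compl m hm)
        (MaxCStar.C0.extend_identity hp.isIdentity_compl m hm) k hk
    · exact h.hausdorffCohomology hΓ hn (MaxCStar.C0.extend hp.isIdentity_compl m hm)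
  · rw [← σ.banachRep_cstarAct]
    exact h.hausdorffCohomology hΓ hn σ.cstarAct
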